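/- Let $G$ be a finite group and let $\mathcal H=\bigotimes_{i}\mathcal H_i$ be a tensor product of finitely many (at least one) nonzero finite-dimensional complex Hilbert spaces, $D=\dim\mathcal H$. Let $R_g=\bigotimes_i R^i_g$ be an on-site unitary representation of $G$, i.e. each $R^i$ is a unitary representation of $G$ on $\mathcal H_i$. A unitary on $\mathcal H$ is called symmetric if it commutes with all $R_g$, $g\in G$. For an ensemble $\mathcal E$ (a Borel probability measure on the compact group of symmetric unitaries) and $k\ge 0$, define the twirl on $\mathcal H^{\otimes k}$ by $\Phi_{\mathcal E}(\rho)=\mathbb E_{U\sim\mathcal E}\big[U^{\otimes k}\rho\,(U^{\otimes k})^\dagger\big]$; let $\Phi^G_H$ be the twirl over the Haar probability measure on the group of symmetric unitaries. Let $$\Phi^G_a(\rho)=\frac1{D^k}\sum_{\sigma\in S_k}\ \sum_{\boldsymbol g\in G^k}\operatorname{tr}\!\big(\rho\,\sigma^{-1}R_{\boldsymbol g}^{-1}\big)\,R_{\boldsymbol g}\,\sigma ,\qquad R_{\boldsymbol g}=R_{g_1}\otimes\cdots\otimes R_{g_k},$$ where $\sigma$ acts on $\mathcal H^{\otimes k}$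 by permuting the $k$ tensor factors. Write $\mathcal A\preceq\mathcal B$ if $\mathcal B-\mathcal A$ is completely positive. (1) Suppose that $G$ acts regularly on every site, i.e. for every $i$ there is a unitary equivalence $\mathcal H_i\cong\mathbb C[G]\otimes\mathbb C^{d_i}$ carrying $R^i_g$ to $R^{\mathrm{reg}}_g\otimes\mathbb 1$, where $R^{\mathrm{reg}}_g|h\rangle=|gh\rangle$. If $k^2\le D/|G|$ then, with $\varepsilon=|G|k^2/D$, $$(1-\varepsilon)\,\Phi^G_H\preceq\Phi^G_a\preceq(1+\varepsilon)\,\Phi^G_H\qquad\text{and}\qquad(1-\varepsilon)\,\Phi^G_a\preceq\Phi^G_H\preceq(1+\varepsilon)\,\Phi^G_a .$$ (2) For every on-site representation as above, every $k$ and every ensemble $\mathcal E$ of symmetric unitaries, $$(1-\varepsilon)\,\Phi^G_a\preceq\Phi_{\mathcal E}\preceq(1+\varepsilon)\,\Phi^G_a,\qquad \varepsilon=\frac{D^{2k}}{k!\,|G|^k}\,\Big\|\big[(\Phi_{\mathcal E}-\Phi^G_a)\otimes\mathbb 1\big](P_{\mathrm{EPR}})\Big\|_\infty ,$$ where $P_{\mathrm{EPR}}$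 is the projector onto the EPR state $D^{-k/2}\sum_x|x\rangle\otimes|x\rangle$ on $\mathcal H^{\otimes k}\otimes\mathcal H^{\otimes k}$ and $\|\cdot\|_\infty$ is the operator norm. -/

import Mathlib

open scoped BigOperators Kronecker

set_option linter.unusedSectionVars false

noncomputable section

namespace SymTwirl

/-! ### Tensor products of matrices and of unitaries -/

/-- The tensor product `⨂ i, A i` of matrices, acting on `⨂ i, ℂ^(c i)`, whose computational basis
is labelled by the functions `x : ∀ i, c i`. -/
def tensor {ι : Type*} [Fintype ι] {c : ι → Type*} (A : ∀ i, Matrix (c i) (c i) ℂ) :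
    Matrix (∀ i, c i) (∀ i, c i) ℂ :=
  Matrix.of fun x y => ∏ i, A i (x i) (y i)

section tensor
variable {ι : Type*} [Fintype ι] [DecidableEq ι] {c : ι → Type*} [∀ i, Fintype (c i)]
  [∀ i, DecidableEq (c i)]

theorem tensor_mul (A B : ∀ i, Matrix (c i) (c i) ℂ) :
    tensor A * tensor B = tensor (fun i => A i * B i) := by
  ext x y
  simp only [tensor, Matrix.mul_apply, Matrix.of_apply, ← Finset.prod_mul_distrib]
  rw [Finset.prod_univ_sum, Fintype.piFinset_univ]

theorem tensor_one : tensor (fun i => (1 : Matrix (c i) (c i) ℂ)) = 1 := by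
  ext x y
  simp only [tensor, Matrix.of_apply, Matrix.one_apply]
  rw [Finset.prod_ite_zero]
  simp [funext_iff]

theorem tensor_conjTranspose (A : ∀ i, Matrix (c i) (c i) ℂ) :
    (tensor A).conjTranspose = tensor (fun i => (A i).conjTranspose) := by
  ext x y
  simp [tensor, Matrix.conjTranspose_apply]

/-- The tensor product of unitaries, as a homomorphism of unitary groups. -/
def tensorUnitary :
    (∀ i, Matrix.unitaryGroup (c i) ℂ) →* Matrix.unitaryGroup (∀ i, c i) ℂ where
  toFun U := ⟨tensor fun i => (U i : Matrix (c i) (c i) ℂ), by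
    rw [Matrix.mem_unitaryGroup_iff, Matrix.star_eq_conjTranspose, tensor_conjTranspose,
      tensor_mul, ← tensor_one]
    congr 1
    funext i
    exact Matrix.mem_unitaryGroup_iff.1 (U i).2⟩
  map_one' := Subtype.ext tensor_one
  map_mul' U V := Subtype.ext (tensor_mul _ _).symm

/-- The on-site representation `R_g = ⨂ i, R i g`. -/
def onSite {G : Type*} [Group G] (R : ∀ i, G →* Matrix.unitaryGroup (c i) ℂ) :
    G →* Matrix.unitaryGroup (∀ i, c i) ℂ :=
  tensorUnitary.comp (MonoidHom.pi R)

end tensor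

/-- The regular representation, `|h⟩ ↦ |g h⟩`. -/
def regularMatrix {G : Type*} [Group G] [DecidableEq G] (g : G) : Matrix G G ℂ :=
  Matrix.of fun x h => if x = g * h then 1 else 0

/-- `R` is a regular action: up to a unitary change of basis `W`, the space is
`ℂ[G] ⊗ ℂ^d` with `G` acting as the regular representation tensored with the identity. -/
def IsRegularAction {G : Type*} [Group G] [Fintype G] [DecidableEq G]
    {N : Type*} [Fintype N] [DecidableEq N] (R : G →* Matrix.unitaryGroup N ℂ) : Prop :=
  ∃ (d : ℕ) (W : Matrix (G × Fin d) N ℂ),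
    W.conjTranspose * W = 1 ∧ W * W.conjTranspose = 1 ∧
      ∀ g, W * (R g : Matrix N N ℂ) =
        (regularMatrix g ⊗ₖ (1 : Matrix (Fin d) (Fin d) ℂ)) * W

/-! ### Symmetric unitaries and their Haar measure -/

section symmetric
variable {G : Type*} [Group G] {N : Type*} [Fintype N] [DecidableEq N]

/-- The group of symmetric unitaries: those commuting with every `R g`. -/
def symUnitary (R : G →* Matrix.unitaryGroup N ℂ) : Subgroup (Matrix.unitaryGroup N ℂ) :=
  Subgroup.centralizer (Set.range R)

instance (R : G →* Matrix.unitaryGroup N ℂ) : MeasurableSpace (symUnitary R) := borel _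

instance (R : G →* Matrix.unitaryGroup N ℂ) : BorelSpace (symUnitary R) := ⟨rfl⟩

open scoped Matrix.Norms.L2Operator in
instance compactSpace_unitaryGroup : CompactSpace (Matrix.unitaryGroup N ℂ) := by
  suffices h : IsCompact (Matrix.unitaryGroup N ℂ : Set (Matrix N N ℂ)) from
    isCompact_iff_compactSpace.1 h
  have hclosed : IsClosed (Matrix.unitaryGroup N ℂ : Set (Matrix N N ℂ)) := by
    have : (Matrix.unitaryGroup N ℂ : Set (Matrix N N ℂ)) = {A | A * star A = 1} := by
      ext A
      exact Matrix.mem_unitaryGroup_iff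
    rw [this]
    exact isClosed_eq (by fun_prop) continuous_const
  have hb : Bornology.IsBounded (Matrix.unitaryGroup N ℂ : Set (Matrix N N ℂ)) := by
    refine (Metric.isBounded_closedBall (x := (0 : Matrix N N ℂ)) (r := 1)).subset ?_
    intro A hA
    rw [mem_closedBall_zero_iff]
    have h1 : ‖A‖ * ‖A‖ = ‖(1 : Matrix N N ℂ)‖ := by
      rw [← CStarRing.norm_star_mul_self (x := A), Matrix.mem_unitaryGroup_iff'.1 hA]
    have h2 : ‖(1 : Matrix N N ℂ)‖ ≤ 1 := by
      rw [Matrix.cstar_norm_def, map_one]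
      exact ContinuousLinearMap.norm_id_le
    nlinarith [norm_nonneg A]
  have := FiniteDimensional.proper ℂ (Matrix N N ℂ)
  exact Metric.isCompact_of_isClosed_isBounded hclosed hb

instance compactSpace_symUnitary (R : G →* Matrix.unitaryGroup N ℂ) :
    CompactSpace (symUnitary R) := by
  suffices h : IsClosed (symUnitary R : Set (Matrix.unitaryGroup N ℂ)) from
    isCompact_iff_compactSpace.1 h.isCompact
  have : (symUnitary R : Set (Matrix.unitaryGroup N ℂ)) = ⋂ g, {U | R g * U = U * R g} := by
    ext U
    simp [symUnitary, Subgroup.mem_centralizer_iff]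
  rw [this]
  exact isClosed_iInter fun g => isClosed_eq (by fun_prop) (by fun_prop)

/-- The Haar probability measure on the compact group of symmetric unitaries. -/
def symHaar (R : G →* Matrix.unitaryGroup N ℂ) : MeasureTheory.Measure (symUnitary R) :=
  MeasureTheory.Measure.haarMeasure ⊤

instance isProbabilityMeasure_symHaar (R : G →* Matrix.unitaryGroup N ℂ) :
    MeasureTheory.IsProbabilityMeasure (symHaar R) :=
  ⟨by simpa [symHaar] using MeasureTheory.Measure.haarMeasure_self (K₀ := (⊤ :
    TopologicalSpace.PositiveCompacts (symUnitary R)))⟩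

end symmetric

/-! ### The exact and the approximate twirl on `k` copies -/

section twirl
variable {G : Type*} [Group G] {N : Type*} [Fintype N] [DecidableEq N]

/-- `U^{⊗ k}`. -/
def tensorPow (k : ℕ) (U : Matrix.unitaryGroup N ℂ) : Matrix (Fin k → N) (Fin k → N) ℂ :=
  tensorUnitary fun _ : Fin k => U

theorem continuous_tensorPow (k : ℕ) : Continuous (tensorPow (N := N) k) := by
  refine continuous_matrix fun x y => ?_
  change Continuous fun U : Matrix.unitaryGroup N ℂ =>
    ∏ i, (U : Matrix N N ℂ) (x i) (y i)
  exact continuous_finsetProd _ fun i _ => continuous_subtype_val.matrix_elem _ _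

/-- `U^{⊗ k} A (U^{⊗ k})†`. -/
def conjPow (k : ℕ) (U : Matrix.unitaryGroup N ℂ) (A : Matrix (Fin k → N) (Fin k → N) ℂ) :
    Matrix (Fin k → N) (Fin k → N) ℂ :=
  tensorPow k U * A * (tensorPow k U).conjTranspose

theorem integrable_conjPow {R : G →* Matrix.unitaryGroup N ℂ}
    (μ : MeasureTheory.Measure (symUnitary R)) [MeasureTheory.IsProbabilityMeasure μ] (k : ℕ)
    (A : Matrix (Fin k → N) (Fin k → N) ℂ) (x y : Fin k → N) :
    MeasureTheory.Integrable
      (fun U : symUnitary R => conjPow k (U : Matrix.unitaryGroup N ℂ) A x y) μ := by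
  have h : Continuous fun U : symUnitary R => tensorPow k (U : Matrix.unitaryGroup N ℂ) :=
    (continuous_tensorPow k).comp continuous_subtype_val
  have hc : Continuous
      (fun U : symUnitary R => conjPow k (U : Matrix.unitaryGroup N ℂ) A x y) :=
    ((h.matrix_mul continuous_const).matrix_mul h.matrix_conjTranspose).matrix_elem x y
  exact hc.integrable_of_hasCompactSupport (HasCompactSupport.of_compactSpace _)

/-- The `k`-fold twirl `Φ_μ(A) = 𝔼_{U ∼ μ} [U^{⊗ k} A (U^{⊗ k})†]` over an ensemble `μ` of symmetric
unitaries (the expectation of a matrix is taken entrywise). -/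
def twirl {R : G →* Matrix.unitaryGroup N ℂ} (μ : MeasureTheory.Measure (symUnitary R))
    [MeasureTheory.IsProbabilityMeasure μ] (k : ℕ) :
    Matrix (Fin k → N) (Fin k → N) ℂ →ₗ[ℂ] Matrix (Fin k → N) (Fin k → N) ℂ where
  toFun A := Matrix.of fun x y =>
    ∫ U : symUnitary R, conjPow k (U : Matrix.unitaryGroup N ℂ) A x y ∂μ
  map_add' A B := by
    ext x y
    simp only [Matrix.of_apply, Matrix.add_apply]
    rw [← MeasureTheory.integral_add (integrable_conjPow μ k A x y)
      (integrable_conjPow μ k B x y)]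
    simp [conjPow, Matrix.mul_add, Matrix.add_mul]
  map_smul' z A := by
    ext x y
    simp only [Matrix.of_apply, Matrix.smul_apply, RingHom.id_apply]
    rw [← MeasureTheory.integral_smul]
    simp [conjPow]

/-- The operator permuting the `k` copies: `σ |y⟩ = |y ∘ σ⁻¹⟩`. -/
def permOp {k : ℕ} (σ : Equiv.Perm (Fin k)) : Matrix (Fin k → N) (Fin k → N) ℂ :=
  Matrix.of fun x y => if x = y ∘ σ.symm then 1 else 0

/-- `R_𝐠 = R_{g 1} ⊗ ⋯ ⊗ R_{g k}`. -/
def copies (R : G →* Matrix.unitaryGroup N ℂ) {k : ℕ} (g : Fin k → G) :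
    Matrix.unitaryGroup (Fin k → N) ℂ :=
  tensorUnitary fun j => R (g j)

/-- The approximate twirl
`Φ_a(ρ) = D^{-k} ∑_σ ∑_𝐠 tr(ρ σ⁻¹ R_𝐠⁻¹) R_𝐠 σ`, where `D` is the dimension of the space. -/
def approxTwirl [Fintype G] (R : G →* Matrix.unitaryGroup N ℂ) (k : ℕ) :
    Matrix (Fin k → N) (Fin k → N) ℂ →ₗ[ℂ] Matrix (Fin k → N) (Fin k → N) ℂ :=
  ((Fintype.card N : ℂ) ^ k)⁻¹ • ∑ σ : Equiv.Perm (Fin k), ∑ g : Fin k → G,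
    ((Matrix.traceLinearMap (Fin k → N) ℂ ℂ).comp
      (LinearMap.mulRight ℂ
        (permOp σ⁻¹ * ((copies R g)⁻¹ : Matrix.unitaryGroup (Fin k → N) ℂ).1))).smulRight
      ((copies R g : Matrix (Fin k → N) (Fin k → N) ℂ) * permOp σ)

end twirl

/-! ### Complete positivity order, EPR state, operator norm -/

section order
variable {K : Type*} [Fintype K] [DecidableEq K]

open scoped Matrix.Norms.L2Operator MatrixOrder ComplexOrder in
/-- `Φ` is completely positive on the matrix algebra (with its operator norm and Loewner order). -/
def IsCP (Φ : Matrix K K ℂ →ₗ[ℂ] Matrix K K ℂ) : Prop :=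
  ∃ F : CompletelyPositiveMap (Matrix K K ℂ) (Matrix K K ℂ), F.toLinearMap = Φ

/-- `Φ ≼ Ψ`: the difference `Ψ - Φ` is completely positive. -/
def CPLE (Φ Ψ : Matrix K K ℂ →ₗ[ℂ] Matrix K K ℂ) : Prop := IsCP (Ψ - Φ)

/-- `(Φ ⊗ 𝟙)(X)` for an operator `X` on `ℂ^K ⊗ ℂ^K`: `Φ` is applied to the blocks of `X` labelled by
the second tensor factor. -/
def ampliate (Φ : Matrix K K ℂ →ₗ[ℂ] Matrix K K ℂ) (X : Matrix (K × K) (K × K) ℂ) :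
    Matrix (K × K) (K × K) ℂ :=
  Matrix.of fun p q => Φ (Matrix.of fun a b => X (a, p.2) (b, q.2)) p.1 q.1

variable (K) in
/-- The EPR (maximally entangled) state vector `|K|^{-1/2} ∑_x |x⟩ ⊗ |x⟩`. -/
def eprVec : K × K → ℂ :=
  fun p => if p.1 = p.2 then ((Real.sqrt (Fintype.card K) : ℝ) : ℂ)⁻¹ else 0

variable (K) in
/-- The projector onto the EPR state. -/
def epr : Matrix (K × K) (K × K) ℂ :=
  Matrix.vecMulVec (eprVec K) (star (eprVec K))

/-- The operator (spectral) norm `‖X‖_∞` on the Euclidean space. -/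
def opNorm (X : Matrix K K ℂ) : ℝ := ‖Matrix.toEuclideanCLM (n := K) (𝕜 := ℂ) X‖

end order

end SymTwirl

end

/-! Everything is compared through Choi matrices, since a map with positive semidefinite Choi matrix
is completely positive. The operators V = R_𝐠 σ form a unitary representation of the wreath product
of G with S_k, and they commute with U^{⊗k} for every symmetric U. The Choi matrix J of Φ_a is
D^{-k} ∑ V ⊗ conj V, that is, κ = k! |G|^k / D^k times the projector onto the invariant vectors.

Ensembles. The Choi matrix X of Φ_E - Φ_a is Hermitian and satisfies JX = XJ = κX. Sandwiching ‖X‖ ±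
X ≥ 0 between two copies of J gives ±X ≤ (‖X‖/κ) J, and the normalization of the EPR projector turns
‖X‖/κ into ε (`cple_twirl_approxTwirl`).

Haar measure. Put C = Φ_a(1). If T commutes with all U^{⊗k}, then Φ_a(T) = T C
(`approxTwirl_eq_mul`). This is the duality input: T commutes with symmetrized tensor products of
arbitrary matrices in the commutant of R, by a Cayley transform and polarization. Since Φ_a is
unchanged by a preceding twirl, Φ_a(A) = Φ_H(A) C, so J is the Choi matrix of Φ_H times C ⊗ 1. All
three are Hermitian, so these factors commute and the order relations follow from bounds on the
spectrum of C (`posSemidef_choi_combination`).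

For regular sites the character of R vanishes off the identity. Splitting S_{k+1} by the image of
the first index then gives C_{k+1} = (1 + D^{-1} ∑ S)(1 ⊗ C_k), with S running over k|G| conjugated
swaps, as with Jucys–Murphy elements. Each S is a Hermitian involution, so the first factor lies
within k|G|/D of 1, and induction bounds C (`approxTwirl_one_bounds`). -/

noncomputable section

namespace SymTwirl

/-! ### Choi matrices and complete positivity -/

section choi
variable {K : Type*} [Fintype K] [DecidableEq K]

/-- The Choi matrix `∑ x y, Φ(|x⟩⟨y|) ⊗ |x⟩⟨y|` of a linear map. -/
def choi : (Matrix K K ℂ →ₗ[ℂ] Matrix K K ℂ) →ₗ[ℂ] Matrix (K × K) (K × K) ℂ where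
  toFun Φ := Matrix.of fun p q => Φ (Matrix.single p.2 q.2 1) p.1 q.1
  map_add' _ _ := rfl
  map_smul' _ _ := rfl

theorem choi_apply (Φ : Matrix K K ℂ →ₗ[ℂ] Matrix K K ℂ) (p q : K × K) :
    choi Φ p q = Φ (Matrix.single p.2 q.2 1) p.1 q.1 := rfl

theorem linearMap_apply_eq_sum {V : Type*} [AddCommMonoid V] [Module ℂ V]
    (f : Matrix K K ℂ →ₗ[ℂ] V) (X : Matrix K K ℂ) :
    f X = ∑ x, ∑ y, X x y • f (Matrix.single x y 1) := by
  conv_lhs => rw [Matrix.matrix_eq_sum_single X]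
  simp only [map_sum, ← map_smul]
  simp

open scoped Matrix.Norms.L2Operator MatrixOrder ComplexOrder

/-- On matrices over the algebra, a Kraus form acts as a sum of conjugations by the block-diagonal
matrices with constant block `L i`, and conjugation preserves positivity. -/
theorem isCP_of_eq_sum {c : Type*} [Fintype c] (L : c → Matrix K K ℂ)
    (Φ : Matrix K K ℂ →ₗ[ℂ] Matrix K K ℂ)
    (h : ∀ X, Φ X = ∑ i, L i * X * (L i).conjTranspose) : IsCP Φ := by
  refine ⟨{ toLinearMap := Φ, map_cstarMatrix_nonneg' := fun k M hM => ?_ }, rfl⟩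
  let E : c → CStarMatrix (Fin k) (Fin k) (Matrix K K ℂ) := fun i =>
    CStarMatrix.ofMatrix (Matrix.diagonal fun _ => L i)
  have key : M.map Φ = ∑ i, E i * M * star (E i) := by
    have hE : ∀ i, E i * M * star (E i) = M.map fun X => L i * X * (L i).conjTranspose := by
      intro i
      have h1 : star (E i) =
          CStarMatrix.ofMatrix (Matrix.diagonal fun _ => (L i).conjTranspose) := by
        ext1 a b
        simp only [CStarMatrix.star_apply, E, CStarMatrix.ofMatrix_apply, Matrix.diagonal_apply]
        by_cases hab : a = b
        · simp [hab, Matrix.star_eq_conjTranspose]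
        · simp [hab, Ne.symm hab]
      rw [h1]
      ext1 a b
      change ((Matrix.diagonal fun _ : Fin k => L i) * CStarMatrix.ofMatrix.symm M *
        Matrix.diagonal fun _ : Fin k => (L i).conjTranspose) a b = _
      rw [Matrix.mul_diagonal, Matrix.diagonal_mul]
      rfl
    simp only [hE]
    ext1 a b
    have hs : ∀ s : Finset c,
        (∑ i ∈ s, M.map fun X => L i * X * (L i).conjTranspose) a b =
          ∑ i ∈ s, L i * M a b * (L i).conjTranspose := fun s => by
      classical
      induction s using Finset.induction_on with
      | empty => rfl
      | insert i s hi ih => rw [Finset.sum_insert hi, Finset.sum_insert hi, CStarMatrix.add_apply,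
          ih, CStarMatrix.map_apply]
    rw [CStarMatrix.map_apply, h, hs]
  change 0 ≤ M.map Φ
  rw [key]
  exact Finset.sum_nonneg fun i _ => star_right_conjugate_nonneg hM (E i)

/-- The direction of Choi's theorem that is needed: factor the Choi matrix as B†B; the conjugated
rows of B, reshaped into square matrices, are Kraus operators. -/
theorem isCP_of_posSemidef_choi {Φ : Matrix K K ℂ →ₗ[ℂ] Matrix K K ℂ}
    (h : (choi Φ).PosSemidef) : IsCP Φ := by
  obtain ⟨B, hB⟩ := CStarAlgebra.nonneg_iff_eq_star_mul_self.1 h.nonneg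
  refine isCP_of_eq_sum (fun r : K × K => Matrix.of fun a x => star (B r (a, x))) Φ fun X => ?_
  rw [linearMap_apply_eq_sum]
  ext a b
  have hc : ∀ x y, Φ (Matrix.single x y 1) a b = ∑ r, star (B r (a, x)) * B r (b, y) := by
    intro x y
    rw [← choi_apply Φ (a, x) (b, y), hB]
    simp [Matrix.mul_apply, Matrix.star_apply]
  simp only [Matrix.sum_apply, Matrix.smul_apply, hc, Matrix.mul_apply, Matrix.of_apply,
    Matrix.conjTranspose_apply, star_star, smul_eq_mul, Finset.mul_sum, Finset.sum_mul]
  rw [Finset.sum_comm_cycle]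
  refine Finset.sum_congr rfl fun r _ => Finset.sum_comm.trans ?_
  exact Finset.sum_congr rfl fun x _ => Finset.sum_congr rfl fun y _ => by ring

theorem cple_of_posSemidef {Φ Ψ : Matrix K K ℂ →ₗ[ℂ] Matrix K K ℂ}
    (h : (choi Ψ - choi Φ).PosSemidef) : CPLE Φ Ψ :=
  isCP_of_posSemidef_choi (by rwa [map_sub])

/-- Right multiplication of the values by `A` multiplies the Choi matrix by `A ⊗ 1`. -/
theorem choi_mulRight (A : Matrix K K ℂ) (Φ : Matrix K K ℂ →ₗ[ℂ] Matrix K K ℂ) :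
    choi (LinearMap.mulRight ℂ A ∘ₗ Φ) = choi Φ * (A ⊗ₖ (1 : Matrix K K ℂ)) := by
  ext ⟨a, x⟩ ⟨b, y⟩
  simp only [choi_apply, LinearMap.comp_apply, LinearMap.mulRight_apply, Matrix.mul_apply,
    Fintype.sum_prod_type, Matrix.kroneckerMap_apply]
  refine Finset.sum_congr rfl fun c _ => ?_
  rw [Finset.sum_eq_single y (fun z _ hz => by simp [hz]) (by simp)]
  simp

/-- If `Φ` commutes with left multiplication by the unitary `V`, its Choi matrix is fixed by
`V ⊗ conj V`. -/
theorem kronecker_mul_choi {V : Matrix K K ℂ} (hV : V * V.conjTranspose = 1)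
    {Φ : Matrix K K ℂ →ₗ[ℂ] Matrix K K ℂ} (h : ∀ X, Φ (V * X) = V * Φ X) :
    (V ⊗ₖ V.map star) * choi Φ = choi Φ := by
  ext ⟨a, x⟩ ⟨b, y⟩
  have h1 : Matrix.single x y (1 : ℂ) = V * ∑ z, star (V x z) • Matrix.single z y (1 : ℂ) := by
    have h2 : ∑ z, star (V x z) • Matrix.single z y (1 : ℂ) =
        V.conjTranspose * Matrix.single x y 1 := by
      ext i j
      simp only [Matrix.sum_apply, Matrix.smul_apply, Matrix.single_apply, Matrix.mul_apply,
        Matrix.conjTranspose_apply]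
      by_cases hj : y = j <;> simp [hj]
    rw [h2, ← Matrix.mul_assoc, hV, Matrix.one_mul]
  rw [choi_apply Φ (a, x) (b, y)]
  simp only [h1, h, map_sum, map_smul, Matrix.mul_apply, Fintype.sum_prod_type,
    Matrix.kroneckerMap_apply, choi_apply, Matrix.sum_apply, Matrix.smul_apply, Matrix.map_apply,
    Finset.mul_sum, smul_eq_mul]
  rw [Finset.sum_comm]
  exact Finset.sum_congr rfl fun c _ => Finset.sum_congr rfl fun z _ => by ring

/-- Applied to the EPR projector, an ampliation gives the normalized Choi matrix. -/
theorem ampliate_epr (Φ : Matrix K K ℂ →ₗ[ℂ] Matrix K K ℂ) :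
    ampliate Φ (epr K) = (Fintype.card K : ℂ)⁻¹ • choi Φ := by
  ext ⟨a, x⟩ ⟨b, y⟩
  have hb : (Matrix.of fun a b => epr K (a, x) (b, y)) =
      (Fintype.card K : ℂ)⁻¹ • Matrix.single x y (1 : ℂ) := by
    have hs : ((Real.sqrt (Fintype.card K) : ℝ) : ℂ)⁻¹ * ((Real.sqrt (Fintype.card K) : ℝ) : ℂ)⁻¹
        = (Fintype.card K : ℂ)⁻¹ := by
      rw [← mul_inv, ← Complex.ofReal_mul, Real.mul_self_sqrt (Nat.cast_nonneg _)]
      simp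
    ext i j
    rcases eq_or_ne i x with rfl | hi <;> rcases eq_or_ne j y with rfl | hj <;>
      simp [epr, eprVec, Matrix.vecMulVec_apply, *, Ne.symm]
  simp only [ampliate, Matrix.of_apply, hb, map_smul, Matrix.smul_apply, choi_apply]

theorem posSemidef_opNorm_sub {X : Matrix K K ℂ} (hX : X.IsHermitian) :
    ((opNorm X : ℂ) • (1 : Matrix K K ℂ) - X).PosSemidef ∧
      ((opNorm X : ℂ) • (1 : Matrix K K ℂ) + X).PosSemidef := by
  have hsa : IsSelfAdjoint X := hX
  have hn : opNorm X = ‖X‖ := (Matrix.cstar_norm_def X).symm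
  have ha : algebraMap ℝ (Matrix K K ℂ) ‖X‖ = (opNorm X : ℂ) • (1 : Matrix K K ℂ) := by
    rw [hn, Algebra.algebraMap_eq_smul_one]
    rfl
  have h1 := hsa.le_algebraMap_norm_self
  have h2 := hsa.neg_algebraMap_norm_le_self
  rw [ha] at h1 h2
  rw [neg_le_iff_add_nonneg'] at h2
  exact ⟨Matrix.le_iff.1 h1, Matrix.nonneg_iff_posSemidef.1 h2⟩

theorem posSemidef_mul_of_commute {A B : Matrix K K ℂ} (hA : A.PosSemidef) (hB : B.PosSemidef)
    (h : Commute A B) : (A * B).PosSemidef :=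
  Matrix.nonneg_iff_posSemidef.1 (h.mul_nonneg hA.nonneg hB.nonneg)

end choi

/-! ### The wreath-product operators R_𝐠 σ and the Choi matrix of Φ_a -/

section symOp
variable {G : Type*} [Group G] {N : Type*} [Fintype N] [DecidableEq N] {k : ℕ}

theorem permOp_mul_apply (σ : Equiv.Perm (Fin k)) (A : Matrix (Fin k → N) (Fin k → N) ℂ)
    (x y : Fin k → N) : (permOp (N := N) σ * A) x y = A (x ∘ σ) y := by
  rw [Matrix.mul_apply, Finset.sum_eq_single (x ∘ σ)]
  · simp [permOp, Function.comp_assoc]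
  · intro z _ hz
    rw [permOp, Matrix.of_apply, if_neg, zero_mul]
    rintro rfl
    exact hz (by simp [Function.comp_assoc])
  · simp

theorem mul_permOp_apply (σ : Equiv.Perm (Fin k)) (A : Matrix (Fin k → N) (Fin k → N) ℂ)
    (x y : Fin k → N) : (A * permOp (N := N) σ) x y = A x (y ∘ σ.symm) := by
  rw [Matrix.mul_apply, Finset.sum_eq_single (y ∘ σ.symm)]
  · simp [permOp]
  · intro z _ hz
    rw [permOp, Matrix.of_apply, if_neg hz, mul_zero]
  · simp

theorem permOp_mul (σ τ : Equiv.Perm (Fin k)) :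
    permOp (N := N) σ * permOp τ = permOp (σ * τ) := by
  ext x y
  rw [mul_permOp_apply]
  rfl

theorem permOp_one : permOp (N := N) (1 : Equiv.Perm (Fin k)) = 1 := by
  ext x y
  simp only [permOp, Matrix.of_apply, Matrix.one_apply]
  rfl

theorem permOp_conjTranspose (σ : Equiv.Perm (Fin k)) :
    (permOp (N := N) σ).conjTranspose = permOp σ⁻¹ := by
  ext x y
  have h : y = x ∘ σ.symm ↔ x = y ∘ (σ⁻¹ : Equiv.Perm (Fin k)).symm := by
    constructor
    · rintro rfl
      ext j
      simp [Equiv.Perm.inv_def]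
    · rintro rfl
      ext j
      simp [Equiv.Perm.inv_def]
  simp only [permOp, Matrix.conjTranspose_apply, Matrix.of_apply, h]
  split_ifs <;> simp

theorem permOp_mul_tensor (σ : Equiv.Perm (Fin k)) (A : Fin k → Matrix N N ℂ) :
    permOp σ * tensor A = tensor (fun j => A (σ.symm j)) * permOp σ := by
  ext x y
  rw [permOp_mul_apply, mul_permOp_apply]
  simp only [tensor, Matrix.of_apply, Function.comp_apply]
  exact Fintype.prod_equiv σ _ _ fun j => by simp

/-- The operator `R_𝐠 σ` on `k` copies. -/
def symOp (R : G →* Matrix.unitaryGroup N ℂ) (σ : Equiv.Perm (Fin k)) (g : Fin k → G) :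
    Matrix (Fin k → N) (Fin k → N) ℂ :=
  (copies R g : Matrix (Fin k → N) (Fin k → N) ℂ) * permOp σ

variable (R : G →* Matrix.unitaryGroup N ℂ)

theorem coe_copies (g : Fin k → G) :
    (copies R g : Matrix (Fin k → N) (Fin k → N) ℂ) =
      tensor fun j => (R (g j) : Matrix N N ℂ) := rfl

theorem symOp_apply (σ : Equiv.Perm (Fin k)) (g : Fin k → G) (x y : Fin k → N) :
    symOp R σ g x y = ∏ j, (R (g j) : Matrix N N ℂ) (x j) (y (σ.symm j)) := by
  rw [symOp, mul_permOp_apply]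
  rfl

/-- The multiplication law of the wreath product: moving σ past R_𝐡 permutes the labels of 𝐡. -/
theorem symOp_mul (σ τ : Equiv.Perm (Fin k)) (g h : Fin k → G) :
    symOp R σ g * symOp R τ h = symOp R (σ * τ) (g * h ∘ σ.symm) := by
  simp only [symOp, coe_copies]
  rw [Matrix.mul_assoc, ← Matrix.mul_assoc (permOp σ), permOp_mul_tensor, Matrix.mul_assoc,
    permOp_mul, ← Matrix.mul_assoc, tensor_mul]
  simp

theorem symOp_conjTranspose_eq (σ : Equiv.Perm (Fin k)) (g : Fin k → G) :
    (symOp R σ g).conjTranspose =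
      permOp σ⁻¹ * ((copies R g)⁻¹ : Matrix.unitaryGroup (Fin k → N) ℂ).1 := by
  rw [symOp, Matrix.conjTranspose_mul, permOp_conjTranspose]
  rfl

theorem symOp_mul_conjTranspose (σ : Equiv.Perm (Fin k)) (g : Fin k → G) :
    symOp R σ g * (symOp R σ g).conjTranspose = 1 := by
  rw [symOp, Matrix.conjTranspose_mul, Matrix.mul_assoc, ← Matrix.mul_assoc (permOp σ),
    permOp_conjTranspose, permOp_mul, mul_inv_cancel, permOp_one, Matrix.one_mul]
  exact Matrix.mem_unitaryGroup_iff.1 (copies R g).2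

theorem conjTranspose_mul_symOp (σ : Equiv.Perm (Fin k)) (g : Fin k → G) :
    (symOp R σ g).conjTranspose * symOp R σ g = 1 :=
  mul_eq_one_comm.1 (symOp_mul_conjTranspose R σ g)

/-- Reindexing a sum over all `R_𝐡 τ` by left multiplication with a fixed `R_𝐠 σ`. -/
theorem sum_symOp_mul_left [Fintype G] {V : Type*} [AddCommMonoid V]
    (F : Matrix (Fin k → N) (Fin k → N) ℂ → V) (σ : Equiv.Perm (Fin k)) (g : Fin k → G) :
    ∑ τ, ∑ h, F (symOp R σ g * symOp R τ h) = ∑ τ, ∑ h, F (symOp R τ h) := by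
  simp only [symOp_mul]
  refine Fintype.sum_equiv (Equiv.mulLeft σ) _ _ fun τ => ?_
  exact Fintype.sum_equiv ((Equiv.arrowCongr σ (Equiv.refl G)).trans (Equiv.mulLeft g)) _ _
    fun h => rfl

theorem approxTwirl_apply [Fintype G] (X : Matrix (Fin k → N) (Fin k → N) ℂ) :
    approxTwirl R k X = ((Fintype.card N : ℂ) ^ k)⁻¹ • ∑ σ, ∑ g,
      Matrix.trace (X * (symOp R σ g).conjTranspose) • symOp R σ g := by
  simp only [approxTwirl, symOp_conjTranspose_eq, LinearMap.smul_apply, LinearMap.sum_apply]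
  rfl

/-- Translate the summation variable by the fixed group element; cyclicity of the trace cancels the
translation inside the coefficients. -/
theorem approxTwirl_symOp_mul [Fintype G] (σ : Equiv.Perm (Fin k)) (g : Fin k → G)
    (X : Matrix (Fin k → N) (Fin k → N) ℂ) :
    approxTwirl R k (symOp R σ g * X) = symOp R σ g * approxTwirl R k X := by
  have key := sum_symOp_mul_left R (fun V : Matrix (Fin k → N) (Fin k → N) ℂ =>
    Matrix.trace (symOp R σ g * X * V.conjTranspose) • V) σ g
  simp only [Matrix.conjTranspose_mul] at key
  have htr : ∀ τ h, Matrix.trace (symOp R σ g * X *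
      ((symOp R τ h).conjTranspose * (symOp R σ g).conjTranspose)) =
        Matrix.trace (X * (symOp R τ h).conjTranspose) := fun τ h => by
    rw [← Matrix.mul_assoc, Matrix.trace_mul_comm, Matrix.mul_assoc (symOp R σ g) X,
      ← Matrix.mul_assoc, conjTranspose_mul_symOp, Matrix.one_mul]
  simp only [htr] at key
  rw [approxTwirl_apply, approxTwirl_apply, ← key]
  simp only [Matrix.mul_smul, Matrix.mul_sum]

/-- Permuting equal tensor factors changes nothing, and U commutes with each R_g. -/
theorem commute_symOp_tensorPow (σ : Equiv.Perm (Fin k)) (g : Fin k → G) (U : symUnitary R) :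
    Commute (symOp R σ g) (tensorPow k (U : Matrix.unitaryGroup N ℂ)) := by
  have hU : ∀ a, (R a : Matrix N N ℂ) * (U : Matrix.unitaryGroup N ℂ) =
      (U : Matrix.unitaryGroup N ℂ) * (R a : Matrix N N ℂ) := fun a =>
    congrArg Subtype.val (Subgroup.mem_centralizer_iff.1 U.2 (R a) ⟨a, rfl⟩)
  change symOp R σ g * tensor (fun _ => ((U : Matrix.unitaryGroup N ℂ) : Matrix N N ℂ)) =
    tensor (fun _ => ((U : Matrix.unitaryGroup N ℂ) : Matrix N N ℂ)) * symOp R σ g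
  rw [symOp, coe_copies, Matrix.mul_assoc, permOp_mul_tensor, ← Matrix.mul_assoc, tensor_mul,
    ← Matrix.mul_assoc, tensor_mul]
  simp only [hU]

/-- `∑ (R_𝐠 σ) ⊗ conj (R_𝐠 σ)`, proportional to the Choi matrix of the approximate twirl. -/
theorem choi_approxTwirl [Fintype G] :
    choi (approxTwirl R k) = ((Fintype.card N : ℂ) ^ k)⁻¹ •
      ∑ σ : Equiv.Perm (Fin k), ∑ g, symOp R σ g ⊗ₖ (symOp R σ g).map star := by
  ext ⟨a, x⟩ ⟨b, y⟩
  simp only [choi_apply, approxTwirl_apply, Matrix.smul_apply, Matrix.sum_apply,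
    Matrix.kroneckerMap_apply, Matrix.map_apply]
  congr 1
  refine Finset.sum_congr rfl fun τ _ => Finset.sum_congr rfl fun h _ => ?_
  rw [Matrix.trace_single_mul, smul_eq_mul, mul_comm, Matrix.conjTranspose_apply, one_smul]

variable {R} in
/-- The Choi matrix of the approximate twirl acts as a multiple of the identity on the Choi matrix
of every map commuting with left multiplication by all `R_𝐠 σ`. -/
theorem choi_approxTwirl_mul [Fintype G]
    {Φ : Matrix (Fin k → N) (Fin k → N) ℂ →ₗ[ℂ] Matrix (Fin k → N) (Fin k → N) ℂ}
    (h : ∀ σ g X, Φ (symOp R σ g * X) = symOp R σ g * Φ X) :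
    choi (approxTwirl R k) * choi Φ =
      (((Fintype.card N : ℂ) ^ k)⁻¹ * (k.factorial * (Fintype.card G : ℂ) ^ k)) • choi Φ := by
  rw [choi_approxTwirl, Matrix.smul_mul, Matrix.sum_mul, mul_smul]
  simp only [Matrix.sum_mul, kronecker_mul_choi (symOp_mul_conjTranspose R _ _) (h _ _),
    Finset.sum_const, Finset.card_univ, Fintype.card_perm, Fintype.card_fin,
    Fintype.card_fun, smul_smul, ← Nat.cast_smul_eq_nsmul ℂ]
  push_cast
  rfl

-- Each V ⊗ conj V is unitary and fixes the Choi matrix of Φ, so its adjoint fixes it too. The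
-- adjoint version is what yields Hermiticity of the Choi matrix of Φ_a below.
variable {R} in
theorem conjTranspose_choi_approxTwirl_mul [Fintype G]
    {Φ : Matrix (Fin k → N) (Fin k → N) ℂ →ₗ[ℂ] Matrix (Fin k → N) (Fin k → N) ℂ}
    (h : ∀ σ g X, Φ (symOp R σ g * X) = symOp R σ g * Φ X) :
    (choi (approxTwirl R k)).conjTranspose * choi Φ =
      (((Fintype.card N : ℂ) ^ k)⁻¹ * (k.factorial * (Fintype.card G : ℂ) ^ k)) • choi Φ := by
  have hfix : ∀ σ g, (symOp R σ g ⊗ₖ (symOp R σ g).map star).conjTranspose * choi Φ =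
      choi Φ := fun σ g => by
    have h1 := kronecker_mul_choi (symOp_mul_conjTranspose R σ g) (h σ g)
    have h2 : (symOp R σ g).map star = ((symOp R σ g).conjTranspose).transpose := by
      ext x y
      simp
    have h4 : ((symOp R σ g).conjTranspose.transpose).conjTranspose =
        (symOp R σ g).transpose := by
      ext x y
      simp
    have h3 : (symOp R σ g ⊗ₖ (symOp R σ g).map star).conjTranspose *
        (symOp R σ g ⊗ₖ (symOp R σ g).map star) = 1 := by
      rw [Matrix.conjTranspose_kronecker, ← Matrix.mul_kronecker_mul, conjTranspose_mul_symOp, h2,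
        h4, ← Matrix.transpose_mul, conjTranspose_mul_symOp, Matrix.transpose_one,
        Matrix.one_kronecker_one]
    rw [← h1, ← Matrix.mul_assoc, h3, Matrix.one_mul, h1]
  rw [choi_approxTwirl, Matrix.conjTranspose_smul, Matrix.smul_mul, Matrix.conjTranspose_sum,
    Matrix.sum_mul, mul_smul]
  simp only [Matrix.conjTranspose_sum, Matrix.sum_mul, hfix,
    Finset.sum_const, Finset.card_univ, Fintype.card_perm, Fintype.card_fin,
    Fintype.card_fun, smul_smul, ← Nat.cast_smul_eq_nsmul ℂ]
  simp

/-- J†J = κJ with κ real and nonzero, and J†J is Hermitian. -/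
theorem isHermitian_choi_approxTwirl [Fintype G] [Nonempty N] :
    (choi (approxTwirl R k)).IsHermitian := by
  have h := conjTranspose_choi_approxTwirl_mul (approxTwirl_symOp_mul R (k := k))
  set κ : ℂ := ((Fintype.card N : ℂ) ^ k)⁻¹ * (k.factorial * (Fintype.card G : ℂ) ^ k)
  have hκ : κ ≠ 0 := by simp [κ, Nat.factorial_ne_zero]
  have hs : star κ = κ := by simp [κ]
  rw [Matrix.IsHermitian, ← smul_right_inj hκ, ← h]
  conv_lhs => rw [← hs]
  rw [← Matrix.conjTranspose_smul, ← h]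
  simp

end symOp

/-! ### Invariance and positivity of ensemble twirls -/

section twirlProps
variable {G : Type*} [Group G] {N : Type*} [Fintype N] [DecidableEq N] {k : ℕ}
  {R : G →* Matrix.unitaryGroup N ℂ} (μ : MeasureTheory.Measure (symUnitary R))
  [MeasureTheory.IsProbabilityMeasure μ]

/-- Lets linear functionals pass through the entrywise expectation. -/
theorem apply_twirl (f : Matrix (Fin k → N) (Fin k → N) ℂ →ₗ[ℂ] ℂ)
    (A : Matrix (Fin k → N) (Fin k → N) ℂ) :
    f (twirl μ k A) = ∫ U : symUnitary R, f (conjPow k (U : Matrix.unitaryGroup N ℂ) A) ∂μ := by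
  have hint : ∀ x y, MeasureTheory.Integrable (fun U : symUnitary R =>
      conjPow k (U : Matrix.unitaryGroup N ℂ) A x y • f (Matrix.single x y 1)) μ := fun x y =>
    (integrable_conjPow μ k A x y).smul_const _
  rw [linearMap_apply_eq_sum f]
  simp_rw [linearMap_apply_eq_sum f (conjPow _ _ _)]
  rw [MeasureTheory.integral_finsetSum _ fun x _ =>
    MeasureTheory.integrable_finsetSum _ fun y _ => hint x y]
  refine Finset.sum_congr rfl fun x _ => ?_
  rw [MeasureTheory.integral_finsetSum _ fun y _ => hint x y]
  refine Finset.sum_congr rfl fun y _ => ?_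
  rw [integral_smul_const]
  rfl

theorem mul_twirl_mul_apply (B C A : Matrix (Fin k → N) (Fin k → N) ℂ) (x y : Fin k → N) :
    (B * twirl μ k A * C) x y =
      ∫ U : symUnitary R, (B * conjPow k (U : Matrix.unitaryGroup N ℂ) A * C) x y ∂μ :=
  apply_twirl μ ((Matrix.entryLinearMap ℂ ℂ x y) ∘ₗ
    (LinearMap.mulRight ℂ C) ∘ₗ (LinearMap.mulLeft ℂ B)) A

theorem twirl_mul_left {V : Matrix (Fin k → N) (Fin k → N) ℂ}
    (hV : ∀ U : symUnitary R, Commute V (tensorPow k (U : Matrix.unitaryGroup N ℂ)))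
    (A : Matrix (Fin k → N) (Fin k → N) ℂ) : twirl μ k (V * A) = V * twirl μ k A := by
  ext x y
  have h := mul_twirl_mul_apply μ V 1 A x y
  rw [Matrix.mul_one] at h
  rw [h]
  refine MeasureTheory.integral_congr_ae (Filter.Eventually.of_forall fun U => ?_)
  simp only [conjPow, Matrix.mul_one]
  rw [← Matrix.mul_assoc, ← (hV U).eq]
  simp only [Matrix.mul_assoc]

theorem twirl_symOp_mul (σ : Equiv.Perm (Fin k)) (g : Fin k → G)
    (A : Matrix (Fin k → N) (Fin k → N) ℂ) :
    twirl μ k (symOp R σ g * A) = symOp R σ g * twirl μ k A :=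
  twirl_mul_left μ (commute_symOp_tensorPow R σ g) A

-- The Choi matrix is the expectation of the rank-one projectors (up to scale) onto the vectorized
-- U^{⊗k}, so its quadratic form is an integral of squared moduli.
open scoped ComplexOrder in
theorem posSemidef_choi_twirl : (choi (twirl μ k)).PosSemidef := by
  have hentry : ∀ (U : symUnitary R) (p q : (Fin k → N) × (Fin k → N)),
      conjPow k (U : Matrix.unitaryGroup N ℂ) (Matrix.single p.2 q.2 1) p.1 q.1 =
        tensorPow k (U : Matrix.unitaryGroup N ℂ) p.1 p.2 *
          star (tensorPow k (U : Matrix.unitaryGroup N ℂ) q.1 q.2) := fun U p q => by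
    simp [conjPow, Matrix.mul_apply, Matrix.single_apply, ite_and]
  have hchoi : ∀ p q, choi (twirl μ k) p q = ∫ U : symUnitary R,
      tensorPow k (U : Matrix.unitaryGroup N ℂ) p.1 p.2 *
        star (tensorPow k (U : Matrix.unitaryGroup N ℂ) q.1 q.2) ∂μ := fun p q => by
    simp only [← hentry]
    rfl
  have hint : ∀ p q : (Fin k → N) × (Fin k → N), MeasureTheory.Integrable
      (fun U : symUnitary R => tensorPow k (U : Matrix.unitaryGroup N ℂ) p.1 p.2 *
        star (tensorPow k (U : Matrix.unitaryGroup N ℂ) q.1 q.2)) μ := fun p q => by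
    simp only [← hentry]
    exact integrable_conjPow μ k _ _ _
  refine Matrix.PosSemidef.of_dotProduct_mulVec_nonneg ?_ fun v => ?_
  · ext p q
    rw [Matrix.conjTranspose_apply, hchoi, hchoi, ← starRingEnd_apply, ← integral_conj]
    simp [mul_comm]
  · have hq : star v ⬝ᵥ (choi (twirl μ k)).mulVec v = ∫ U : symUnitary R,
        ((Complex.normSq (∑ p, star (v p) *
          tensorPow k (U : Matrix.unitaryGroup N ℂ) p.1 p.2) : ℝ) : ℂ) ∂μ := by
      simp only [dotProduct, Matrix.mulVec, Pi.star_apply, hchoi, Finset.mul_sum]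
      simp only [← MeasureTheory.integral_mul_const, ← MeasureTheory.integral_const_mul]
      have hint' : ∀ p q : (Fin k → N) × (Fin k → N), MeasureTheory.Integrable
        (fun U : symUnitary R => star (v p) * (tensorPow k (U : Matrix.unitaryGroup N ℂ) p.1 p.2 *
          star (tensorPow k (U : Matrix.unitaryGroup N ℂ) q.1 q.2) * v q)) μ := fun p q =>
        ((hint p q).mul_const _).const_mul _
      simp only [← MeasureTheory.integral_finsetSum _ fun q _ => hint' _ q]
      rw [← MeasureTheory.integral_finsetSum _ fun p _ =>
        MeasureTheory.integrable_finsetSum _ fun q _ => hint' p q]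
      congr 1
      ext U
      rw [← Complex.mul_conj, map_sum, Finset.sum_mul_sum]
      refine Finset.sum_congr rfl fun p _ => Finset.sum_congr rfl fun q _ => ?_
      simp only [map_mul, starRingEnd_apply, star_star]
      ring
    rw [hq, integral_complex_ofReal]
    exact_mod_cast MeasureTheory.integral_nonneg fun U => Complex.normSq_nonneg _

/-- The coefficients tr(A V†) do not change when A is conjugated by U^{⊗k}, because V commutes with
U^{⊗k}. -/
theorem approxTwirl_twirl [Fintype G] (A : Matrix (Fin k → N) (Fin k → N) ℂ) :
    approxTwirl R k (twirl μ k A) = approxTwirl R k A := by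
  rw [approxTwirl_apply, approxTwirl_apply]
  congr 1
  refine Finset.sum_congr rfl fun τ _ => Finset.sum_congr rfl fun h _ => ?_
  congr 1
  have h1 := apply_twirl μ (Matrix.traceLinearMap (Fin k → N) ℂ ℂ ∘ₗ
    LinearMap.mulRight ℂ (symOp R τ h).conjTranspose) A
  simp only [LinearMap.comp_apply, LinearMap.mulRight_apply, Matrix.traceLinearMap_apply] at h1
  rw [h1]
  have h2 : ∀ U : symUnitary R, Matrix.trace (conjPow k (U : Matrix.unitaryGroup N ℂ) A *
      (symOp R τ h).conjTranspose) = Matrix.trace (A * (symOp R τ h).conjTranspose) := fun U => by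
    have hc : (tensorPow k (U : Matrix.unitaryGroup N ℂ)).conjTranspose *
        (symOp R τ h).conjTranspose = (symOp R τ h).conjTranspose *
          (tensorPow k (U : Matrix.unitaryGroup N ℂ)).conjTranspose := by
      rw [← Matrix.conjTranspose_mul, (commute_symOp_tensorPow R τ h U).eq,
        Matrix.conjTranspose_mul]
    have hu : (tensorPow k (U : Matrix.unitaryGroup N ℂ)).conjTranspose *
        tensorPow k (U : Matrix.unitaryGroup N ℂ) = 1 :=
      Matrix.mem_unitaryGroup_iff'.1 (tensorUnitary fun _ : Fin k =>
        (U : Matrix.unitaryGroup N ℂ)).2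
    rw [conjPow, Matrix.mul_assoc, hc, ← Matrix.mul_assoc, Matrix.trace_mul_comm,
      ← Matrix.mul_assoc, ← Matrix.mul_assoc, hu, Matrix.one_mul]
  simp [h2]

/-- Left invariance of Haar measure makes the twirled operator invariant under conjugation by
U^{⊗k}. -/
theorem commute_twirl_symHaar (A : Matrix (Fin k → N) (Fin k → N) ℂ) (U : symUnitary R) :
    Commute (twirl (symHaar R) k A) (tensorPow k (U : Matrix.unitaryGroup N ℂ)) := by
  have hu : (tensorPow k (U : Matrix.unitaryGroup N ℂ)).conjTranspose *
      tensorPow k (U : Matrix.unitaryGroup N ℂ) = 1 :=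
    Matrix.mem_unitaryGroup_iff'.1 (tensorUnitary fun _ : Fin k =>
      (U : Matrix.unitaryGroup N ℂ)).2
  have hinv : conjPow k (U : Matrix.unitaryGroup N ℂ) (twirl (symHaar R) k A) =
      twirl (symHaar R) k A := by
    ext x y
    rw [conjPow, mul_twirl_mul_apply]
    have : (symHaar R).IsMulLeftInvariant := by
      unfold symHaar
      infer_instance
    change _ = ∫ V : symUnitary R, conjPow k (V : Matrix.unitaryGroup N ℂ) A x y ∂_
    conv_rhs => rw [← MeasureTheory.integral_mul_left_eq_self (μ := symHaar R) _ U]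
    refine MeasureTheory.integral_congr_ae (Filter.Eventually.of_forall fun V => ?_)
    have hm : tensorPow k ((U * V : symUnitary R) : Matrix.unitaryGroup N ℂ) =
        tensorPow k (U : Matrix.unitaryGroup N ℂ) * tensorPow k (V : Matrix.unitaryGroup N ℂ) :=
      (tensor_mul _ _).symm
    simp only [conjPow, hm, Matrix.conjTranspose_mul, Matrix.mul_assoc]
  rw [commute_iff_eq]
  conv_lhs => rw [← hinv]
  rw [conjPow, Matrix.mul_assoc, hu, Matrix.mul_one]

end twirlProps

/-! ### Arbitrary ensembles against Φ_a -/

section ensemble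
variable {G : Type*} [Group G] [Fintype G] {N : Type*} [Fintype N] [DecidableEq N] {k : ℕ}

theorem opNorm_smul {K : Type*} [Fintype K] [DecidableEq K] (c : ℂ) (X : Matrix K K ℂ) :
    opNorm (c • X) = ‖c‖ * opNorm X := by
  simp [opNorm, norm_smul]

open scoped ComplexOrder in
/-- The comparison of an ensemble twirl with the approximate twirl, in terms of the distance of
their Choi matrices. -/
theorem cple_twirl_approxTwirl [Nonempty N] (R : G →* Matrix.unitaryGroup N ℂ)
    (μ : MeasureTheory.Measure (symUnitary R)) [MeasureTheory.IsProbabilityMeasure μ] (ε : ℝ)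
    (hε : ε = (Fintype.card N : ℝ) ^ (2 * k) / ((k.factorial : ℝ) * (Fintype.card G : ℝ) ^ k) *
      opNorm (ampliate (twirl μ k - approxTwirl R k) (epr (Fin k → N)))) :
    CPLE (((1 - ε : ℝ) : ℂ) • approxTwirl R k) (twirl μ k) ∧
      CPLE (twirl μ k) (((1 + ε : ℝ) : ℂ) • approxTwirl R k) := by
  have hJ := isHermitian_choi_approxTwirl R (k := k)
  have hX : (choi (twirl μ k - approxTwirl R k)).IsHermitian := by
    rw [map_sub]
    exact (posSemidef_choi_twirl μ).isHermitian.sub hJ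
  have hJJ := choi_approxTwirl_mul (approxTwirl_symOp_mul R (k := k))
  have hJX := choi_approxTwirl_mul (R := R) (Φ := twirl μ k - approxTwirl R k) fun σ g X => by
    simp [twirl_symOp_mul, approxTwirl_symOp_mul, Matrix.mul_sub]
  have hsub : choi (twirl μ k) = choi (twirl μ k - approxTwirl R k) + choi (approxTwirl R k) := by
    simp
  set J := choi (approxTwirl R k)
  set X := choi (twirl μ k - approxTwirl R k)
  have hκ' : ((Fintype.card N : ℂ) ^ k)⁻¹ * (k.factorial * (Fintype.card G : ℂ) ^ k) =
      (((Fintype.card N : ℝ) ^ k)⁻¹ * (k.factorial * (Fintype.card G : ℝ) ^ k) : ℝ) := by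
    push_cast
    rfl
  rw [hκ'] at hJJ hJX
  set κ : ℝ := ((Fintype.card N : ℝ) ^ k)⁻¹ * (k.factorial * (Fintype.card G : ℝ) ^ k) with hκd
  have hD : (0 : ℝ) < Fintype.card N := by exact_mod_cast Fintype.card_pos
  have hG : (0 : ℝ) < Fintype.card G := by exact_mod_cast Fintype.card_pos
  have hf : (0 : ℝ) < k.factorial := by exact_mod_cast k.factorial_pos
  have hκ : 0 < κ := by positivity
  have hκc : (κ : ℂ) ≠ 0 := by exact_mod_cast hκ.ne'
  -- The EPR projector contributes D^{-k}, which reduces the prefactor D^{2k}/(k! |G|^k) to 1/κ.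
  have hεκ : ε * κ = opNorm X := by
    rw [hε, ampliate_epr, opNorm_smul, hκd]
    simp only [norm_inv, Complex.norm_natCast, Fintype.card_fun, Fintype.card_fin]
    push_cast
    field_simp
    rw [pow_mul, pow_right_comm]
  have hXJ : X * J = (κ : ℂ) • X := by
    have := congrArg Matrix.conjTranspose hJX
    rwa [Matrix.conjTranspose_mul, Matrix.conjTranspose_smul, hX.eq, hJ.eq, Complex.star_def,
      Complex.conj_ofReal] at this
  -- Conjugating ‖X‖ + Y ≥ 0 by J gives ‖X‖ κ J + κ² Y ≥ 0; divide by κ². It is used for Y = X and Y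
  -- = -X.
  have hpos : ∀ Y : Matrix ((Fin k → N) × (Fin k → N)) ((Fin k → N) × (Fin k → N)) ℂ,
      J * Y = (κ : ℂ) • Y → Y * J = (κ : ℂ) • Y →
        ((opNorm X : ℂ) • 1 + Y).PosSemidef → (Y + (ε : ℂ) • J).PosSemidef := by
    intro Y h1 h2 h
    have h3 := (h.mul_mul_conjTranspose_same J).smul (a := (κ⁻¹ * κ⁻¹ : ℝ)) (by positivity)
    convert h3 using 1
    rw [hJ.eq, Matrix.mul_add, Matrix.add_mul, h1, Matrix.smul_mul, h2, Matrix.mul_smul,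
      Matrix.mul_one, Matrix.smul_mul, hJJ, ← hεκ, smul_add, smul_smul, ← Complex.coe_smul,
      ← Complex.coe_smul, smul_smul, smul_smul, smul_smul, add_comm]
    congr 1
    · congr 1
      push_cast
      field_simp
    · rw [show ((κ⁻¹ * κ⁻¹ : ℝ) : ℂ) * κ * κ = 1 by push_cast; field_simp, one_smul]
  obtain ⟨hm, hp⟩ := posSemidef_opNorm_sub hX
  constructor
  · refine cple_of_posSemidef ?_
    convert hpos X hJX hXJ hp using 1
    rw [hsub, map_smul]
    push_cast
    module
  · refine cple_of_posSemidef ?_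
    convert hpos (-X) (by simp [hJX]) (by simp [hXJ]) (by rwa [← sub_eq_add_neg]) using 1
    rw [hsub, map_smul]
    push_cast
    module

end ensemble

/-! ### From symmetric unitaries to the whole commutant of R -/

section duality
variable {N : Type*} [Fintype N] [DecidableEq N] {k : ℕ}

theorem tensor_smul_const (c : ℂ) (A : Matrix N N ℂ) :
    tensor (fun _ : Fin k => c • A) = c ^ k • tensor (fun _ : Fin k => A) := by
  ext x y
  simp [tensor, Finset.prod_mul_distrib]

/-- Commuting with the tensor powers along infinitely many points of a polynomial curve of matrices
entails commuting with the tensor powers along the whole curve. -/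
theorem commute_tensor_of_infinite {T : Matrix (Fin k → N) (Fin k → N) ℂ}
    (F : Matrix N N (Polynomial ℂ)) {s : Set ℂ} (hs : s.Infinite)
    (h : ∀ t ∈ s, Commute T (tensor fun _ : Fin k => F.map (Polynomial.eval t))) (t : ℂ) :
    Commute T (tensor fun _ : Fin k => F.map (Polynomial.eval t)) := by
  let P : (Fin k → N) → (Fin k → N) → Polynomial ℂ := fun x y =>
    ∑ z, Polynomial.C (T x z) * ∏ j, F (z j) (y j) -
      ∑ z, (∏ j, F (x j) (z j)) * Polynomial.C (T z y)
  have hP : ∀ t x y, (P x y).eval t =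
      (T * (tensor fun _ : Fin k => F.map (Polynomial.eval t))) x y -
        ((tensor fun _ : Fin k => F.map (Polynomial.eval t)) * T) x y := fun t x y => by
    simp [P, Matrix.mul_apply, tensor, Polynomial.eval_finsetSum, Polynomial.eval_prod]
  have hP0 : ∀ x y, P x y = 0 := fun x y => by
    refine Polynomial.eq_zero_of_infinite_isRoot _ (hs.mono fun t ht => ?_)
    change (P x y).eval t = 0
    rw [hP, (h t ht).eq, sub_self]
  rw [commute_iff_eq]
  ext x y
  rw [← sub_eq_zero, ← hP, hP0, Polynomial.eval_zero]

theorem commute_nonsing_inv {A Y : Matrix N N ℂ} (h : Commute A Y) (hY : IsUnit Y.det) :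
    Commute A Y⁻¹ := by
  rw [commute_iff_eq]
  calc A * Y⁻¹ = Y⁻¹ * Y * A * Y⁻¹ := by rw [Matrix.nonsing_inv_mul _ hY, Matrix.one_mul]
    _ = Y⁻¹ * A := by
      rw [Matrix.mul_assoc Y⁻¹, ← h.eq, ← Matrix.mul_assoc, Matrix.mul_nonsing_inv_cancel_right _ _ hY]

theorem unitary_of_commute_conjTranspose {X : Matrix N N ℂ} (h : Commute X X.conjTranspose)
    (hX : IsUnit X.conjTranspose.det) :
    X * (X.conjTranspose)⁻¹ ∈ Matrix.unitaryGroup N ℂ := by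
  have hX' : IsUnit X.det := by
    rw [Matrix.det_conjTranspose] at hX
    simpa using hX
  rw [Matrix.mem_unitaryGroup_iff, Matrix.star_eq_conjTranspose, Matrix.conjTranspose_mul,
    Matrix.conjTranspose_nonsing_inv, Matrix.conjTranspose_conjTranspose, ← Matrix.mul_assoc,
    (commute_nonsing_inv h hX).eq, Matrix.mul_assoc (X.conjTranspose)⁻¹,
    Matrix.mul_nonsing_inv _ hX', Matrix.mul_one, Matrix.nonsing_inv_mul _ hX]

variable {G : Type*} [Group G] {R : G →* Matrix.unitaryGroup N ℂ}
  {T : Matrix (Fin k → N) (Fin k → N) ℂ}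

/-- Cayley transform: with X_t = (1 + A) + t(A - 1) and Y_t = (1 + A) - t(A - 1), the quotient X_t
Y_t⁻¹ is a symmetric unitary for imaginary t whenever Y_t is invertible, and equals A at t = 1.
After clearing denominators the curve is polynomial in t, so commutation passes from the imaginary
axis to t = 1. -/
theorem commute_tensor_of_isHermitian
    (hT : ∀ U : symUnitary R, Commute T (tensorPow k (U : Matrix.unitaryGroup N ℂ)))
    {A : Matrix N N ℂ} (hA : A.IsHermitian) (hAR : ∀ g, Commute (R g : Matrix N N ℂ) A) :
    Commute T (tensor fun _ : Fin k => A) := by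
  let Xp : Matrix N N (Polynomial ℂ) :=
    (1 + A).map Polynomial.C + (Polynomial.X : Polynomial ℂ) • (A - 1).map Polynomial.C
  let Yp : Matrix N N (Polynomial ℂ) :=
    (1 + A).map Polynomial.C - (Polynomial.X : Polynomial ℂ) • (A - 1).map Polynomial.C
  let Xm : ℂ → Matrix N N ℂ := fun t => (1 + A) + t • (A - 1)
  let Ym : ℂ → Matrix N N ℂ := fun t => (1 + A) - t • (A - 1)
  have hXp : ∀ t, Xp.map (Polynomial.eval t) = Xm t := fun t => by
    ext i j
    simp [Xp, Xm]
  have hYp : ∀ t, Yp.map (Polynomial.eval t) = Ym t := fun t => by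
    ext i j
    simp [Yp, Ym]
  -- This is det(Y)² X Y⁻¹ where Y is invertible. The extra factor det(Y) makes the curve vanish at
  -- the singular points, so these need no separate argument.
  let F : Matrix N N (Polynomial ℂ) := Yp.det • (Xp * Yp.adjugate)
  have hF : ∀ t, F.map (Polynomial.eval t) = (Ym t).det • (Xm t * (Ym t).adjugate) := fun t => by
    have h1 : (Polynomial.evalRingHom t) Yp.det = (Ym t).det := by
      rw [RingHom.map_det, ← hYp]
      rfl
    have h2 : Yp.adjugate.map (Polynomial.eval t) = (Ym t).adjugate := by
      rw [← hYp]
      exact RingHom.map_adjugate (Polynomial.evalRingHom t) Yp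
    have h3 : (Xp * Yp.adjugate).map (Polynomial.eval t) = Xm t * (Ym t).adjugate := by
      rw [← hXp, ← h2]
      exact Matrix.map_mul (f := Polynomial.evalRingHom t)
    rw [← h3, ← h1]
    ext i j
    simp [F]
  have hXY : ∀ t, Commute (Xm t) (Ym t) := fun t => by
    have h1 : Commute (1 + A) (A - 1) := (Commute.one_left _).add_left
      ((Commute.refl A).sub_right (Commute.one_right A))
    exact ((Commute.refl _).sub_right (h1.smul_right t)).add_left
      ((h1.symm.smul_left t).sub_right (Commute.refl _))
  have hRX : ∀ g t, Commute (R g : Matrix N N ℂ) (Xm t) := fun g t =>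
    ((Commute.one_right _).add_right (hAR g)).add_right
      (((hAR g).sub_right (Commute.one_right _)).smul_right t)
  have hRY : ∀ g t, Commute (R g : Matrix N N ℂ) (Ym t) := fun g t =>
    ((Commute.one_right _).add_right (hAR g)).sub_right
      (((hAR g).sub_right (Commute.one_right _)).smul_right t)
  have hs : (Set.range fun τ : ℝ => (τ : ℂ) * Complex.I).Infinite :=
    Set.infinite_range_of_injective fun a b hab => by simpa using hab
  have key := commute_tensor_of_infinite (T := T) F hs ?_ 1
  · have hY1 : Ym 1 = (2 : ℂ) • (1 : Matrix N N ℂ) := by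
      simp only [Ym]
      module
    have hX1 : Xm 1 = A * Ym 1 := by
      rw [hY1, Matrix.mul_smul, Matrix.mul_one]
      simp only [Xm]
      module
    have hdet : (Ym 1).det ≠ 0 := by
      rw [hY1, Matrix.det_smul]
      simp
    rw [hF, hX1, Matrix.mul_assoc, Matrix.mul_adjugate, Matrix.mul_smul, Matrix.mul_one,
      smul_smul, tensor_smul_const] at key
    have h2 := key.smul_right (((Ym 1).det * (Ym 1).det) ^ k)⁻¹
    rwa [smul_smul, inv_mul_cancel₀ (pow_ne_zero _ (mul_ne_zero hdet hdet)), one_smul] at h2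
  · rintro _ ⟨τ, rfl⟩
    set t : ℂ := (τ : ℂ) * Complex.I with ht
    change Commute T (tensor fun _ => F.map (Polynomial.eval t))
    rw [hF]
    by_cases hdet : (Ym t).det = 0
    · rw [hdet, zero_smul]
      -- Writing 0 as a multiple of 1 also covers k = 0, where the tensor power of 0 is the
      -- identity.
      have h0 : (0 : Matrix N N ℂ) = (0 : ℂ) • 1 := by simp
      rw [h0, tensor_smul_const, tensor_one]
      exact (Commute.one_right T).smul_right _
    · have hstar : (Xm t).conjTranspose = Ym t := by
        simp only [Xm, Ym, Matrix.conjTranspose_add, Matrix.conjTranspose_smul,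
          Matrix.conjTranspose_sub, Matrix.conjTranspose_one, hA.eq, ht]
        simp only [star_mul', Complex.star_def, Complex.conj_ofReal, Complex.conj_I]
        module
      have hu : IsUnit (Ym t).det := isUnit_iff_ne_zero.2 hdet
      have hU := unitary_of_commute_conjTranspose (hstar ▸ hXY t) (hstar ▸ hu)
      rw [hstar] at hU
      have hS : (⟨_, hU⟩ : Matrix.unitaryGroup N ℂ) ∈ symUnitary R := by
        rw [symUnitary, Subgroup.mem_centralizer_iff]
        rintro _ ⟨g, rfl⟩
        exact Subtype.ext ((hRX g t).mul_right (commute_nonsing_inv (hRY g t) hu)).eq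
      have h1 : (Ym t).det • (Xm t * (Ym t).adjugate) =
          ((Ym t).det * (Ym t).det) • (Xm t * (Ym t)⁻¹) := by
        rw [Matrix.inv_def, Ring.inverse_eq_inv', Matrix.mul_smul, smul_smul, mul_assoc,
          mul_inv_cancel₀ hdet, mul_one]
      rw [h1, tensor_smul_const]
      exact (hT ⟨_, hS⟩).smul_right _

/-- Write A = H₁ + iH₂ with Hermitian parts, which still commute with R. The line H₁ + tH₂ is
Hermitian for real t, and polynomial continuation reaches t = i. -/
theorem commute_tensor_const
    (hT : ∀ U : symUnitary R, Commute T (tensorPow k (U : Matrix.unitaryGroup N ℂ)))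
    {A : Matrix N N ℂ} (hAR : ∀ g, Commute (R g : Matrix N N ℂ) A) :
    Commute T (tensor fun _ : Fin k => A) := by
  have hAR' : ∀ g, Commute (R g : Matrix N N ℂ) A.conjTranspose := fun g => by
    have h := congrArg Matrix.conjTranspose (hAR g⁻¹).eq
    have h2 : ((R g⁻¹ : Matrix.unitaryGroup N ℂ) : Matrix N N ℂ).conjTranspose = R g := by
      rw [map_inv]
      exact Matrix.conjTranspose_conjTranspose _
    rw [Matrix.conjTranspose_mul, Matrix.conjTranspose_mul, h2] at h
    exact h.symm
  let H₁ : Matrix N N ℂ := (1 / 2 : ℂ) • (A + A.conjTranspose)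
  let H₂ : Matrix N N ℂ := (-Complex.I / 2) • (A - A.conjTranspose)
  let F : Matrix N N (Polynomial ℂ) :=
    H₁.map Polynomial.C + (Polynomial.X : Polynomial ℂ) • H₂.map Polynomial.C
  have hF : ∀ t, F.map (Polynomial.eval t) = H₁ + t • H₂ := fun t => by
    ext i j
    simp [F]
    ring
  have hA : A = H₁ + Complex.I • H₂ := by
    simp only [H₁, H₂, smul_smul]
    rw [show Complex.I * (-Complex.I / 2) = 1 / 2 by
      rw [mul_div_assoc', mul_neg, Complex.I_mul_I, neg_neg]]
    module
  have h₁ : H₁.IsHermitian := by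
    simp only [Matrix.IsHermitian, H₁, Matrix.conjTranspose_smul, Matrix.conjTranspose_add,
      Matrix.conjTranspose_conjTranspose]
    rw [add_comm]
    simp
  have h₂ : H₂.IsHermitian := by
    simp only [Matrix.IsHermitian, H₂, Matrix.conjTranspose_smul, Matrix.conjTranspose_sub,
      Matrix.conjTranspose_conjTranspose]
    simp only [Complex.star_def, map_div₀, map_neg, Complex.conj_I, map_ofNat]
    module
  rw [hA, ← hF]
  refine commute_tensor_of_infinite F (s := Set.range ((↑) : ℝ → ℂ))
    (Set.infinite_range_of_injective Complex.ofReal_injective) ?_ _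
  rintro _ ⟨τ, rfl⟩
  rw [hF]
  refine commute_tensor_of_isHermitian hT (h₁.add ?_) fun g => ?_
  · rw [Matrix.IsHermitian, Matrix.conjTranspose_smul, h₂.eq, Complex.star_def,
      Complex.conj_ofReal]
  · exact (((hAR g).add_right (hAR' g)).smul_right _).add_right
      ((((hAR g).sub_right (hAR' g)).smul_right _).smul_right _)

/-- Ryser's formula: polarization of the tensor power. -/
theorem sum_perm_tensor (M : Fin k → Matrix N N ℂ) :
    ∑ σ : Equiv.Perm (Fin k), tensor (fun j => M (σ j)) =
      ∑ S : Finset (Fin k), (-1 : ℂ) ^ S.card • tensor (fun _ : Fin k => ∑ i ∈ Sᶜ, M i) := by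
  ext x y
  simp only [Matrix.sum_apply, Matrix.smul_apply, tensor, Matrix.of_apply]
  have hprod : ∀ S : Finset (Fin k), ∏ j, ∑ i ∈ Sᶜ, M i (x j) (y j) =
      ∑ φ : Fin k → Fin k, if S ⊆ (Finset.univ.image φ)ᶜ then ∏ j, M (φ j) (x j) (y j) else 0 := by
    intro S
    rw [Finset.prod_univ_sum, ← Finset.sum_filter]
    refine Finset.sum_congr ?_ fun _ _ => rfl
    ext φ
    simp only [Fintype.mem_piFinset, Finset.mem_compl, Finset.mem_filter, Finset.mem_univ,
      true_and, Finset.subset_iff, Finset.mem_image, not_exists]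
    exact ⟨fun h a ha j hj => h j (hj ▸ ha), fun h j hj => h hj j rfl⟩
  simp only [hprod, Finset.smul_sum]
  rw [Finset.sum_comm]
  -- Inclusion–exclusion: the alternating sum over subsets disjoint from the image of φ vanishes
  -- unless φ is surjective, hence a permutation.
  have hsign : ∀ φ : Fin k → Fin k, ∑ S : Finset (Fin k), (-1 : ℂ) ^ S.card •
      (if S ⊆ (Finset.univ.image φ)ᶜ then ∏ j, M (φ j) (x j) (y j) else 0) =
        if Function.Bijective φ then ∏ j, M (φ j) (x j) (y j) else 0 := by
    intro φ
    have h1 : (∑ S ∈ ((Finset.univ.image φ)ᶜ).powerset, (-1 : ℂ) ^ S.card) =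
        if Function.Bijective φ then 1 else 0 := by
      have h2 := Finset.sum_powerset_neg_one_pow_card (x := (Finset.univ.image φ)ᶜ)
      have h3 : (Finset.univ.image φ)ᶜ = ∅ ↔ Function.Bijective φ := by
        rw [Finset.compl_eq_empty_iff, ← Finite.surjective_iff_bijective,
          Finset.eq_univ_iff_forall]
        simp [Function.Surjective]
      simp only [h3] at h2
      exact_mod_cast congrArg (Int.cast (R := ℂ)) h2
    simp only [smul_eq_mul, mul_ite, mul_zero]
    have h4 : Finset.univ.filter (· ⊆ (Finset.univ.image φ)ᶜ) =
        ((Finset.univ.image φ)ᶜ).powerset := by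
      ext S
      simp
    rw [← Finset.sum_filter, ← Finset.sum_mul, h4, h1]
    simp
  simp only [hsign]
  rw [← Finset.sum_filter]
  refine Finset.sum_bij (fun σ _ => ⇑σ) 
    (fun σ _ => Finset.mem_filter.2 ⟨Finset.mem_univ _, σ.bijective⟩)
    (fun σ _ τ _ h => DFunLike.coe_injective h) (fun φ hφ => ?_) fun σ _ => rfl
  exact ⟨Equiv.ofBijective φ (Finset.mem_filter.1 hφ).2, Finset.mem_univ _, rfl⟩

theorem commute_sum_perm_tensor
    (hT : ∀ U : symUnitary R, Commute T (tensorPow k (U : Matrix.unitaryGroup N ℂ)))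
    {M : Fin k → Matrix N N ℂ} (hM : ∀ i g, Commute (R g : Matrix N N ℂ) (M i)) :
    Commute T (∑ σ : Equiv.Perm (Fin k), tensor (fun j => M (σ j))) := by
  rw [sum_perm_tensor]
  exact Commute.sum_right _ _ _ fun S _ => (commute_tensor_const hT fun g =>
    Commute.sum_right _ _ _ fun i _ => hM i g).smul_right _

end duality

/-! ### Factorization Φ_a = Φ_H · Φ_a(1) and reduction to the spectrum of Φ_a(1) -/

section haar
variable {G : Type*} [Group G] [Fintype G] {N : Type*} [Fintype N] [DecidableEq N] {k : ℕ}
  {R : G →* Matrix.unitaryGroup N ℂ} {T : Matrix (Fin k → N) (Fin k → N) ℂ}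

theorem commute_sum_conj (X : Matrix N N ℂ) (g : G) :
    Commute (R g : Matrix N N ℂ)
      (∑ h, (R h : Matrix N N ℂ) * X * (R h : Matrix N N ℂ).conjTranspose) := by
  have hu : (R g : Matrix N N ℂ).conjTranspose * (R g : Matrix N N ℂ) = 1 :=
    Matrix.mem_unitaryGroup_iff'.1 (R g).2
  rw [commute_iff_eq, Matrix.sum_mul, Matrix.mul_sum]
  refine Fintype.sum_equiv (Equiv.mulLeft g) _ _ fun h => ?_
  simp only [Equiv.coe_mulLeft, map_mul, Submonoid.coe_mul, Matrix.conjTranspose_mul]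
  simp only [Matrix.mul_assoc, hu, Matrix.mul_one]

/-- Averaging the matrix units |e_i⟩⟨b_i| over G puts them in the commutant of R, so their
symmetrized tensor product commutes with T. Expanding it gives ∑ V |e⟩⟨b| V†. -/
theorem commute_sum_symOp_conj
    (hT : ∀ U : symUnitary R, Commute T (tensorPow k (U : Matrix.unitaryGroup N ℂ)))
    (e b : Fin k → N) :
    Commute T (Matrix.of fun a c => ∑ σ, ∑ g, symOp R σ g a e * star (symOp R σ g c b)) := by
  have h := commute_sum_perm_tensor hT (M := fun i => ∑ h, (R h : Matrix N N ℂ) *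
    Matrix.single (e i) (b i) 1 * (R h : Matrix N N ℂ).conjTranspose)
    fun i g => commute_sum_conj _ g
  convert h using 1
  ext a c
  rw [Matrix.sum_apply, Matrix.of_apply]
  refine Fintype.sum_equiv (Equiv.inv _) _ _ fun σ => ?_
  simp only [symOp_apply, tensor, Matrix.of_apply, Matrix.sum_apply, star_prod,
    ← Finset.prod_mul_distrib]
  rw [Finset.prod_univ_sum, Fintype.piFinset_univ]
  refine Finset.sum_congr rfl fun g _ => Finset.prod_congr rfl fun j _ => ?_
  simp [Matrix.mul_apply, Matrix.single_apply, ite_and, Equiv.Perm.inv_def]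

/-- On the commutant of the tensor powers of the symmetric unitaries the approximate twirl is the
multiplication by its value at the identity. -/
theorem approxTwirl_eq_mul
    (hT : ∀ U : symUnitary R, Commute T (tensorPow k (U : Matrix.unitaryGroup N ℂ))) :
    approxTwirl R k T = T * approxTwirl R k 1 := by
  rw [approxTwirl_apply, approxTwirl_apply, Matrix.mul_smul]
  congr 1
  ext a e
  -- Take the (a, b) entry of T Q = Q T for Q = ∑ V |e⟩⟨b| V† and sum over b. One side becomes the
  -- (a, e) entry of T ∑ conj(tr V) V, the other that of ∑ tr(T V†) V.
  have h := Finset.sum_congr (rfl : (Finset.univ : Finset (Fin k → N)) = _) fun b _ =>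
    congrFun (congrFun (commute_sum_symOp_conj hT e b).eq a) b
  simp only [← Fintype.sum_prod_type', Matrix.mul_apply, Matrix.of_apply, Finset.mul_sum,
    Finset.sum_mul] at h
  simp only [← Fintype.sum_prod_type', Matrix.mul_apply, Matrix.sum_apply, Matrix.smul_apply,
    Matrix.trace, Matrix.diag_apply, Matrix.one_mul, Matrix.conjTranspose_apply, smul_eq_mul,
    Finset.mul_sum, Finset.sum_mul]
  refine Eq.trans ?_ (h.symm.trans ?_)
  · exact Fintype.sum_equiv ⟨fun x => (x.2.2.2, x.2.2.1, x.1, x.2.1),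
      fun x => (x.2.2.1, x.2.2.2, x.2.1, x.1), fun _ => rfl, fun _ => rfl⟩ _ _ fun x => by
        simp only [Equiv.coe_fn_mk]
        ring
  · exact Fintype.sum_equiv ⟨fun x => (x.2.1, (x.2.2.1, x.2.2.2), x.1),
      fun x => (x.2.2, x.1, x.2.1.1, x.2.1.2), fun _ => rfl, fun _ => rfl⟩ _ _ fun x => by
        simp only [Equiv.coe_fn_mk]
        ring

theorem approxTwirl_eq_twirl_mul (A : Matrix (Fin k → N) (Fin k → N) ℂ) :
    approxTwirl R k A = twirl (symHaar R) k A * approxTwirl R k 1 := by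
  rw [← approxTwirl_eq_mul (commute_twirl_symHaar A), approxTwirl_twirl]

theorem choi_approxTwirl_eq_mul :
    choi (approxTwirl R k) = choi (twirl (symHaar R) k) * (approxTwirl R k 1 ⊗ₖ 1) := by
  rw [← choi_mulRight]
  congr 1
  ext1 A
  exact approxTwirl_eq_twirl_mul A

/-- The value at 1 is a partial trace of the Choi matrix, which is Hermitian. -/
theorem isHermitian_approxTwirl_one [Nonempty N] (R : G →* Matrix.unitaryGroup N ℂ) (k : ℕ) :
    (approxTwirl R k 1).IsHermitian := by
  have h1 : ∀ a b, approxTwirl R k 1 a b = ∑ x, choi (approxTwirl R k) (a, x) (b, x) := by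
    intro a b
    have h2 : (1 : Matrix (Fin k → N) (Fin k → N) ℂ) = ∑ x, Matrix.single x x 1 := by
      ext i j
      simp [Matrix.sum_apply, Matrix.one_apply, Matrix.single_apply, ite_and]
    rw [h2, map_sum, Matrix.sum_apply]
    rfl
  ext a b
  rw [Matrix.conjTranspose_apply, h1, h1, star_sum]
  exact Finset.sum_congr rfl fun x _ => (isHermitian_choi_approxTwirl R).apply _ _

open scoped ComplexOrder

/-- The combination equals the Choi matrix of Φ_H times (α + βC) ⊗ 1. The factors commute because
the Choi matrix of Φ_a, their product for α = 0 and β = 1, is Hermitian. -/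
theorem posSemidef_choi_combination [Nonempty N] {α β : ℂ}
    (h : (α • (1 : Matrix (Fin k → N) (Fin k → N) ℂ) + β • approxTwirl R k 1).PosSemidef) :
    (α • choi (twirl (symHaar R) k) + β • choi (approxTwirl R k)).PosSemidef := by
  have hH := posSemidef_choi_twirl (k := k) (symHaar R)
  have hC := isHermitian_approxTwirl_one R k
  have hcomm : Commute (choi (twirl (symHaar R) k))
      (approxTwirl R k 1 ⊗ₖ (1 : Matrix (Fin k → N) (Fin k → N) ℂ)) := by
    rw [commute_iff_eq]
    have h1 := isHermitian_choi_approxTwirl R (k := k)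
    rw [choi_approxTwirl_eq_mul, Matrix.IsHermitian, Matrix.conjTranspose_mul,
      Matrix.conjTranspose_kronecker, hC.eq, Matrix.conjTranspose_one, hH.isHermitian.eq] at h1
    exact h1.symm
  have hk : (α • (1 : Matrix (Fin k → N) (Fin k → N) ℂ) + β • approxTwirl R k 1) ⊗ₖ
      (1 : Matrix (Fin k → N) (Fin k → N) ℂ) = α • 1 + β • (approxTwirl R k 1 ⊗ₖ 1) := by
    rw [Matrix.add_kronecker, Matrix.smul_kronecker, Matrix.smul_kronecker,
      Matrix.one_kronecker_one]
  have h2 := posSemidef_mul_of_commute hH (h.kronecker Matrix.PosSemidef.one) (by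
    rw [hk]
    exact ((Commute.one_right _).smul_right α).add_right (hcomm.smul_right β))
  rw [hk, Matrix.mul_add, Matrix.mul_smul, Matrix.mul_smul, Matrix.mul_one,
    ← choi_approxTwirl_eq_mul] at h2
  exact h2

/-- The lower bound 1 - ε/2, sharper than 1 - ε, is what the last relation needs: (1 + ε)(1 - ε/2) ≥
1 for 0 ≤ ε ≤ 1. -/
theorem cple_of_approxTwirl_one_bounds [Nonempty N] {ε : ℝ} (h0 : 0 ≤ ε) (h1 : ε ≤ 1)
    (hlow : (approxTwirl R k 1 - ((1 - ε / 2 : ℝ) : ℂ) • 1).PosSemidef)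
    (hup : (((1 + ε : ℝ) : ℂ) • 1 - approxTwirl R k 1).PosSemidef) :
    (CPLE (((1 - ε : ℝ) : ℂ) • twirl (symHaar R) k) (approxTwirl R k) ∧
      CPLE (approxTwirl R k) (((1 + ε : ℝ) : ℂ) • twirl (symHaar R) k)) ∧
    (CPLE (((1 - ε : ℝ) : ℂ) • approxTwirl R k) (twirl (symHaar R) k) ∧
      CPLE (twirl (symHaar R) k) (((1 + ε : ℝ) : ℂ) • approxTwirl R k)) := by
  have hone : ∀ r : ℝ, 0 ≤ r →
      (r • (1 : Matrix (Fin k → N) (Fin k → N) ℂ)).PosSemidef := fun r hr =>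
    Matrix.PosSemidef.one.smul hr
  have hre : ∀ (r : ℝ) (X : Matrix (Fin k → N) (Fin k → N) ℂ), r • X = (r : ℂ) • X :=
    fun r X => rfl
  refine ⟨⟨?_, ?_⟩, ?_, ?_⟩ <;> refine cple_of_posSemidef ?_ <;> rw [map_smul]
  · have h := posSemidef_choi_combination (R := R) (k := k) (α := -((1 - ε : ℝ) : ℂ)) (β := 1) (by
      convert hlow.add (hone (ε / 2) (by positivity)) using 1
      rw [hre]
      push_cast
      module)
    convert h using 1
    module
  · have h := posSemidef_choi_combination (R := R) (k := k) (α := ((1 + ε : ℝ) : ℂ)) (β := -1) (by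
      convert hup using 1
      module)
    convert h using 1
    module
  · have h := posSemidef_choi_combination (R := R) (k := k) (α := 1) (β := -((1 - ε : ℝ) : ℂ)) (by
      -- 1 - (1 - ε)C = (1 - ε)((1 + ε) - C) + ε².
      convert (hup.smul (a := (1 - ε)) (by linarith)).add (hone (ε ^ 2) (by positivity)) using 1
      rw [hre, hre]
      push_cast
      module)
    convert h using 1
    module
  · have h := posSemidef_choi_combination (R := R) (k := k) (α := -1) (β := ((1 + ε : ℝ) : ℂ)) (by
      convert (hlow.smul (a := (1 + ε)) (by linarith)).add
        (hone (ε / 2 - ε ^ 2 / 2) (by nlinarith)) using 1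
      rw [hre, hre]
      push_cast
      module)
    convert h using 1
    module

end haar

/-! ### Recursion for Φ_a(1) in the number of copies -/

section recursion
variable {G : Type*} [Group G] {N : Type*} [Fintype N] [DecidableEq N] {k : ℕ}

/-- `1 ⊗ A` on `k + 1` copies. -/
def liftCopies : Matrix (Fin k → N) (Fin k → N) ℂ →ₗ[ℂ]
    Matrix (Fin (k + 1) → N) (Fin (k + 1) → N) ℂ where
  toFun A := ((1 : Matrix N N ℂ) ⊗ₖ A).submatrix (Fin.consEquiv fun _ => N).symm
    (Fin.consEquiv fun _ => N).symm
  map_add' A B := by rw [Matrix.kronecker_add]; rfl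
  map_smul' c A := by rw [Matrix.kronecker_smul]; rfl

theorem liftCopies_apply (A : Matrix (Fin k → N) (Fin k → N) ℂ) (x y : Fin (k + 1) → N) :
    liftCopies A x y = if x 0 = y 0 then A (Fin.tail x) (Fin.tail y) else 0 := by
  change (1 : Matrix N N ℂ) (x 0) (y 0) * A (Fin.tail x) (Fin.tail y) = _
  simp [Matrix.one_apply]

theorem liftCopies_one : liftCopies (1 : Matrix (Fin k → N) (Fin k → N) ℂ) = 1 := by
  change ((1 : Matrix N N ℂ) ⊗ₖ (1 : Matrix (Fin k → N) (Fin k → N) ℂ)).submatrix _ _ = _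
  rw [Matrix.one_kronecker_one, Matrix.submatrix_one_equiv]

open scoped ComplexOrder in
theorem posSemidef_liftCopies {A : Matrix (Fin k → N) (Fin k → N) ℂ} (h : A.PosSemidef) :
    (liftCopies A).PosSemidef :=
  (Matrix.PosSemidef.one.kronecker h).submatrix _

variable (R : G →* Matrix.unitaryGroup N ℂ)

/-- Coset decomposition of S_{k+1} over the stabilizer of 0, with the transpositions (0 p) as
representatives. -/
theorem decomposeFin_symm_eq_mul (p : Fin (k + 1)) (τ : Equiv.Perm (Fin k)) :
    Equiv.Perm.decomposeFin.symm (p, τ) =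
      Equiv.swap 0 p * Equiv.Perm.decomposeFin.symm (0, τ) := by
  ext j
  refine Fin.cases ?_ (fun j => ?_) j <;> simp

theorem decomposeFin_symm_zero_inv (τ : Equiv.Perm (Fin k)) :
    (Equiv.Perm.decomposeFin.symm (0, τ)).symm = Equiv.Perm.decomposeFin.symm (0, τ.symm) := by
  ext j
  rw [(Equiv.symm_apply_eq _).2]
  refine Fin.cases ?_ (fun j => ?_) j <;> simp

theorem liftCopies_symOp (τ : Equiv.Perm (Fin k)) (g : Fin k → G) :
    liftCopies (symOp R τ g) = symOp R (Equiv.Perm.decomposeFin.symm (0, τ)) (Fin.cons 1 g) := by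
  ext x y
  rw [liftCopies_apply, symOp_apply, symOp_apply, decomposeFin_symm_zero_inv, Fin.prod_univ_succ]
  simp [Matrix.one_apply, Fin.tail]

/-- `R_h` acting on the first copy. -/
def firstOp (k : ℕ) (h : G) : Matrix (Fin (k + 1) → N) (Fin (k + 1) → N) ℂ :=
  symOp R 1 (Fin.cons h 1)

/-- The permutation of the first copy with another one, conjugated by `R_h` on the first copy. -/
def conjSwap (q : Fin k) (h : G) : Matrix (Fin (k + 1) → N) (Fin (k + 1) → N) ℂ :=
  firstOp R k h * permOp (Equiv.swap 0 q.succ) * (firstOp R k h).conjTranspose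

theorem permOp_eq_symOp (σ : Equiv.Perm (Fin k)) : permOp σ = symOp R σ 1 := by
  ext x y
  rw [symOp_apply]
  simp [permOp, Matrix.one_apply, Finset.prod_ite_zero, funext_iff]

theorem firstOp_conjTranspose (h : G) :
    (firstOp R k h).conjTranspose = firstOp R k h⁻¹ := by
  have h1 : firstOp R k h * firstOp R k h⁻¹ = 1 := by
    have h2 : (Fin.cons h 1 * (Fin.cons h⁻¹ 1) ∘ (1 : Equiv.Perm (Fin (k + 1))).symm :
        Fin (k + 1) → G) = 1 := by
      ext j
      refine Fin.cases ?_ (fun j => ?_) j <;> simp [Equiv.Perm.one_def]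
    rw [firstOp, firstOp, symOp_mul, h2, mul_one, ← permOp_eq_symOp, permOp_one]
  rw [← Matrix.mul_one (firstOp R k h).conjTranspose, ← h1, ← Matrix.mul_assoc, firstOp,
    conjTranspose_mul_symOp, Matrix.one_mul]

theorem firstOp_mul_liftCopies (h : G) (τ : Equiv.Perm (Fin k)) (g : Fin k → G) :
    firstOp R k h * liftCopies (symOp R τ g) =
      symOp R (Equiv.Perm.decomposeFin.symm (0, τ)) (Fin.cons h g) := by
  rw [liftCopies_symOp, firstOp, symOp_mul, one_mul]
  congr 1
  ext j
  refine Fin.cases ?_ (fun j => ?_) j <;> simp [Equiv.Perm.one_def]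

theorem firstOp_eq_kronecker (h : G) : firstOp R k h =
    ((R h : Matrix N N ℂ) ⊗ₖ (1 : Matrix (Fin k → N) (Fin k → N) ℂ)).submatrix
      (Fin.consEquiv fun _ => N).symm (Fin.consEquiv fun _ => N).symm := by
  ext x y
  rw [firstOp, symOp_apply, Fin.prod_univ_succ]
  change _ = (R h : Matrix N N ℂ) (x 0) (y 0) *
    (1 : Matrix (Fin k → N) (Fin k → N) ℂ) (Fin.tail x) (Fin.tail y)
  simp [Matrix.one_apply, Finset.prod_ite_zero, funext_iff, Equiv.Perm.one_def, Fin.tail]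

theorem commute_firstOp_liftCopies (h : G) (A : Matrix (Fin k → N) (Fin k → N) ℂ) :
    Commute (firstOp R k h) (liftCopies A) := by
  rw [commute_iff_eq, firstOp_eq_kronecker]
  change _ * ((1 : Matrix N N ℂ) ⊗ₖ A).submatrix _ _ = ((1 : Matrix N N ℂ) ⊗ₖ A).submatrix _ _ * _
  rw [Matrix.submatrix_mul_equiv, Matrix.submatrix_mul_equiv, ← Matrix.mul_kronecker_mul,
    ← Matrix.mul_kronecker_mul]
  simp

theorem trace_firstOp_mul_liftCopies (h : G) (A : Matrix (Fin k → N) (Fin k → N) ℂ) :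
    Matrix.trace (firstOp R k h * liftCopies A) =
      Matrix.trace (R h : Matrix N N ℂ) * Matrix.trace A := by
  rw [firstOp_eq_kronecker]
  change Matrix.trace (_ * ((1 : Matrix N N ℂ) ⊗ₖ A).submatrix _ _) = _
  rw [Matrix.submatrix_mul_equiv, ← Matrix.mul_kronecker_mul, Matrix.mul_one, Matrix.one_mul,
    ← Matrix.trace_kronecker]
  exact Fintype.sum_equiv (Fin.consEquiv fun _ => N).symm _ _ fun _ => rfl

/-- The reindexing of `G^(k+1)` adapted to products of a conjugated swap with an operator on the
last `k` copies. -/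
def swapEquiv (q : Fin k) : G × (Fin k → G) ≃ (Fin (k + 1) → G) where
  toFun p := Fin.cons p.1 1 * (Fin.cons p.1⁻¹ p.2 : Fin (k + 1) → G) ∘ Equiv.swap 0 q.succ
  invFun g := ((g q.succ)⁻¹,
    Fin.tail (((Fin.cons (g q.succ)⁻¹ 1)⁻¹ * g : Fin (k + 1) → G) ∘ Equiv.swap 0 q.succ))
  left_inv p := by
    have h1 : (Fin.cons p.1 1 * (Fin.cons p.1⁻¹ p.2 : Fin (k + 1) → G) ∘
      Equiv.swap 0 q.succ : Fin (k + 1) → G) q.succ = p.1⁻¹ := by simp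
    refine Prod.ext ?_ ?_
    · simp only [h1, inv_inv]
    · simp only [h1, inv_inv, inv_mul_cancel_left, Function.comp_assoc]
      ext j
      simp [Fin.tail]
  right_inv g := by
    have h2 : (Fin.cons (g q.succ)⁻¹⁻¹ (Fin.tail (((Fin.cons (g q.succ)⁻¹ 1)⁻¹ * g :
        Fin (k + 1) → G) ∘ Equiv.swap 0 q.succ)) : Fin (k + 1) → G) =
          ((Fin.cons (g q.succ)⁻¹ 1)⁻¹ * g : Fin (k + 1) → G) ∘ Equiv.swap 0 q.succ := by
      ext j
      refine Fin.cases ?_ (fun j => ?_) j <;> simp [Fin.tail]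
    simp only [h2, Function.comp_assoc]
    ext j
    simp

theorem conjSwap_mul_liftCopies (q : Fin k) (h : G) (τ : Equiv.Perm (Fin k)) (g : Fin k → G) :
    conjSwap R q h * liftCopies (symOp R τ g) =
      symOp R (Equiv.Perm.decomposeFin.symm (q.succ, τ)) (swapEquiv q (h, g)) := by
  rw [conjSwap, Matrix.mul_assoc, firstOp_conjTranspose, firstOp_mul_liftCopies, firstOp,
    permOp_eq_symOp R, symOp_mul, symOp_mul, decomposeFin_symm_eq_mul q.succ, one_mul]
  congr 1
  ext j
  simp [swapEquiv, Equiv.Perm.one_def]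

/-- R_h on the first copy commutes with 1 ⊗ A, so it drops out of the trace. The partial trace of a
swap over the first copy is the identity. -/
theorem trace_conjSwap_mul_liftCopies (q : Fin k) (h : G)
    (A : Matrix (Fin k → N) (Fin k → N) ℂ) :
    Matrix.trace (conjSwap R q h * liftCopies A) = Matrix.trace A := by
  have h1 : Commute (firstOp R k h).conjTranspose (liftCopies A) := by
    rw [firstOp_conjTranspose]
    exact commute_firstOp_liftCopies R _ A
  rw [conjSwap, Matrix.mul_assoc, h1.eq, Matrix.mul_assoc, Matrix.trace_mul_comm,
    Matrix.mul_assoc, Matrix.mul_assoc, firstOp, conjTranspose_mul_symOp, Matrix.mul_one]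
  simp only [Matrix.trace, Matrix.diag_apply, permOp_mul_apply, liftCopies_apply]
  rw [← (Fin.consEquiv fun _ => N).sum_comp, Fintype.sum_prod_type, Finset.sum_comm]
  refine Finset.sum_congr rfl fun x _ => ?_
  rw [Finset.sum_eq_single (x q)]
  · have ht : Fin.tail ((Fin.cons (x q) x : Fin (k + 1) → N) ∘ Equiv.swap 0 q.succ) = x := by
      ext j
      by_cases hj : j = q
      · simp [hj, Fin.tail]
      · simp [Fin.tail, Equiv.swap_apply_of_ne_of_ne, hj]
    simp [Fin.consEquiv, ht]
  · intro a _ ha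
    simp [Fin.consEquiv, ha.symm]
  · simp

variable [Fintype G]

theorem approxTwirl_one (k : ℕ) : approxTwirl R k 1 = ((Fintype.card N : ℂ) ^ k)⁻¹ •
    ∑ σ : Equiv.Perm (Fin k), ∑ g : Fin k → G,
      star (Matrix.trace (symOp R σ g)) • symOp R σ g := by
  simp only [approxTwirl_apply, Matrix.one_mul, Matrix.trace_conjTranspose]

/-- Recursion in the number of copies, if the character of `R` is that of a multiple of the regular
representation. -/
theorem approxTwirl_succ_one [Nonempty N]
    (hR : ∀ g, g ≠ 1 → Matrix.trace (R g : Matrix N N ℂ) = 0) (k : ℕ) :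
    approxTwirl R (k + 1) 1 = (1 + (Fintype.card N : ℂ)⁻¹ • ∑ q : Fin k, ∑ h, conjSwap R q h) *
      liftCopies (approxTwirl R k 1) := by
  have hD : (Fintype.card N : ℂ) ≠ 0 := by simp
  -- Permutations fixing 0: the trace factors through tr R_h, which leaves only h = 1, with value D.
  have hzero : ∀ τ : Equiv.Perm (Fin k), ∑ g : Fin (k + 1) → G,
      star (Matrix.trace (symOp R (Equiv.Perm.decomposeFin.symm (0, τ)) g)) •
        symOp R (Equiv.Perm.decomposeFin.symm (0, τ)) g =
      (Fintype.card N : ℂ) • ∑ g : Fin k → G, star (Matrix.trace (symOp R τ g)) •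
        liftCopies (symOp R τ g) := fun τ => by
    rw [← (Fin.consEquiv fun _ => G).sum_comp, Fintype.sum_prod_type, Finset.sum_eq_single 1]
    · rw [Finset.smul_sum]
      refine Finset.sum_congr rfl fun g _ => ?_
      change star (Matrix.trace (symOp R _ (Fin.cons 1 g))) • symOp R _ (Fin.cons 1 g) = _
      rw [← firstOp_mul_liftCopies, trace_firstOp_mul_liftCopies]
      have h1 : firstOp R k 1 = 1 := by
        rw [firstOp_eq_kronecker]
        simp
      simp [h1, smul_smul]
    · intro h _ hh
      refine Finset.sum_eq_zero fun g _ => ?_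
      change star (Matrix.trace (symOp R _ (Fin.cons h g))) • symOp R _ (Fin.cons h g) = _
      rw [← firstOp_mul_liftCopies, trace_firstOp_mul_liftCopies, hR h hh]
      simp
    · simp
  -- Permutations moving 0: each conjugated swap contributes without changing the trace, hence
  -- without the factor D.
  have hsucc : ∀ (q : Fin k) (τ : Equiv.Perm (Fin k)), ∑ g : Fin (k + 1) → G,
      star (Matrix.trace (symOp R (Equiv.Perm.decomposeFin.symm (q.succ, τ)) g)) •
        symOp R (Equiv.Perm.decomposeFin.symm (q.succ, τ)) g =
      (∑ h, conjSwap R q h) * ∑ g : Fin k → G, star (Matrix.trace (symOp R τ g)) •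
        liftCopies (symOp R τ g) := fun q τ => by
    rw [← (swapEquiv q).sum_comp, Fintype.sum_prod_type, Finset.sum_mul]
    refine Finset.sum_congr rfl fun h _ => ?_
    rw [Finset.mul_sum]
    refine Finset.sum_congr rfl fun g _ => ?_
    rw [← conjSwap_mul_liftCopies, trace_conjSwap_mul_liftCopies, Matrix.mul_smul]
  rw [approxTwirl_one, approxTwirl_one, ← Equiv.Perm.decomposeFin.symm.sum_comp,
    Fintype.sum_prod_type, Fin.sum_univ_succ]
  simp only [hzero, hsucc, map_smul, map_sum]
  simp only [← Finset.smul_sum, ← Finset.mul_sum, ← Finset.sum_mul]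
  rw [Matrix.mul_smul, Matrix.add_mul, Matrix.one_mul, Matrix.smul_mul, pow_succ, mul_inv,
    mul_smul, smul_add, smul_smul (Fintype.card N : ℂ)⁻¹, inv_mul_cancel₀ hD, one_smul]

end recursion

/-! ### Spectral bounds for Φ_a(1) -/

section bounds
open scoped ComplexOrder

theorem posSemidef_one_add_of_involution {K : Type*} [Fintype K] [DecidableEq K]
    {P : Matrix K K ℂ} (h : P.IsHermitian) (h2 : P * P = 1) : (1 + P).PosSemidef := by
  have h3 := (Matrix.posSemidef_conjTranspose_mul_self (1 + P)).smul (a := (1 / 2 : ℝ))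
    (by norm_num)
  convert h3 using 1
  rw [Matrix.conjTranspose_add, Matrix.conjTranspose_one, h.eq, Matrix.mul_add, Matrix.mul_one,
    Matrix.add_mul, Matrix.one_mul, h2]
  module

variable {G : Type*} [Group G] {N : Type*} [Fintype N] [DecidableEq N] {k : ℕ}
  (R : G →* Matrix.unitaryGroup N ℂ)

theorem isHermitian_permOp_swap (i j : Fin k) :
    (permOp (N := N) (Equiv.swap i j)).IsHermitian := by
  rw [Matrix.IsHermitian, permOp_conjTranspose, Equiv.swap_inv]

theorem isHermitian_conjSwap (q : Fin k) (h : G) : (conjSwap R q h).IsHermitian := by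
  rw [conjSwap, Matrix.IsHermitian, Matrix.conjTranspose_mul, Matrix.conjTranspose_mul,
    Matrix.conjTranspose_conjTranspose, (isHermitian_permOp_swap _ _).eq, Matrix.mul_assoc]

theorem conjSwap_mul_self (q : Fin k) (h : G) : conjSwap R q h * conjSwap R q h = 1 := by
  have h1 : (firstOp R k h).conjTranspose * firstOp R k h = 1 := conjTranspose_mul_symOp R _ _
  have h2 : firstOp R k h * (firstOp R k h).conjTranspose = 1 := symOp_mul_conjTranspose R _ _
  have h3 : permOp (N := N) (Equiv.swap 0 q.succ) * permOp (Equiv.swap 0 q.succ) = 1 := by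
    rw [permOp_mul, Equiv.swap_mul_self, permOp_one]
  calc _ = firstOp R k h * permOp (Equiv.swap 0 q.succ) *
        ((firstOp R k h).conjTranspose * firstOp R k h) * permOp (Equiv.swap 0 q.succ) *
          (firstOp R k h).conjTranspose := by simp only [conjSwap, Matrix.mul_assoc]
    _ = 1 := by
      rw [h1, Matrix.mul_one, Matrix.mul_assoc (firstOp R k h), h3, Matrix.mul_one, h2]

variable [Fintype G]

/-- A sum of k|G| Hermitian involutions S, for each of which 1 + S ≥ 0. -/
theorem posSemidef_add_sum_conjSwap : (((k * Fintype.card G : ℝ)) •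
      (1 : Matrix (Fin (k + 1) → N) (Fin (k + 1) → N) ℂ) +
    ∑ q : Fin k, ∑ h, conjSwap R q h).PosSemidef := by
  have h := Matrix.posSemidef_sum Finset.univ fun (q : Fin k) _ =>
    Matrix.posSemidef_sum Finset.univ fun (h : G) _ =>
      posSemidef_one_add_of_involution (isHermitian_conjSwap R q h) (conjSwap_mul_self R q h)
  convert h using 1
  simp only [Finset.sum_add_distrib, Finset.sum_const, Finset.card_univ, Fintype.card_fin,
    smul_smul, ← Nat.cast_smul_eq_nsmul ℝ]

theorem posSemidef_sub_sum_conjSwap : (((k * Fintype.card G : ℝ)) •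
      (1 : Matrix (Fin (k + 1) → N) (Fin (k + 1) → N) ℂ) -
    ∑ q : Fin k, ∑ h, conjSwap R q h).PosSemidef := by
  have h := Matrix.posSemidef_sum Finset.univ fun (q : Fin k) _ =>
    Matrix.posSemidef_sum Finset.univ fun (h : G) _ =>
      posSemidef_one_add_of_involution (isHermitian_conjSwap R q h).neg
        (by rw [neg_mul_neg, conjSwap_mul_self R q h])
  convert h using 1
  simp only [← sub_eq_add_neg, Finset.sum_sub_distrib, Finset.sum_const, Finset.card_univ,
    Fintype.card_fin, smul_smul, ← Nat.cast_smul_eq_nsmul ℝ]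

theorem approxTwirl_zero_one : approxTwirl R 0 1 = 1 := by
  have h : ∀ (σ : Equiv.Perm (Fin 0)) (g : Fin 0 → G), symOp R σ g = 1 := fun σ g => by
    ext x y
    rw [symOp_apply, Subsingleton.elim x y]
    simp
  rw [approxTwirl_one]
  simp [h]

variable {R}

/-- Bounds for the product of two commuting positive semidefinite matrices. -/
theorem posSemidef_mul_sub_smul {K : Type*} [Fintype K] [DecidableEq K] {A B : Matrix K K ℂ}
    {a b c : ℝ} (h : Commute A B) (hA : A.PosSemidef) (hA' : (A - a • 1).PosSemidef)
    (hB : (B - b • 1).PosSemidef) (hb : 0 ≤ b) (hc : c ≤ a * b) : (A * B - c • 1).PosSemidef := by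
  have h1 := posSemidef_mul_of_commute hA hB
    (h.sub_right ((Commute.one_right A).smul_right b))
  -- AB - c = A(B - b) + b(A - a) + (ab - c).
  convert (h1.add (hA'.smul hb)).add (Matrix.PosSemidef.one.smul (sub_nonneg.2 hc)) using 1
  rw [Matrix.mul_sub, Matrix.mul_smul, Matrix.mul_one]
  module

theorem posSemidef_smul_sub_mul {K : Type*} [Fintype K] [DecidableEq K] {A B : Matrix K K ℂ}
    {a b c : ℝ} (h : Commute A B) (hA : A.PosSemidef) (hA' : (a • 1 - A).PosSemidef)
    (hB : (b • 1 - B).PosSemidef) (hb : 0 ≤ b) (hc : a * b ≤ c) : (c • 1 - A * B).PosSemidef := by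
  have h1 := posSemidef_mul_of_commute hA hB
    (((Commute.one_right A).smul_right b).sub_right h)
  convert (h1.add (hA'.smul hb)).add (Matrix.PosSemidef.one.smul (sub_nonneg.2 hc)) using 1
  rw [Matrix.mul_sub, Matrix.mul_smul, Matrix.mul_one]
  module

/-- Each recursion step multiplies by a factor between 1 - k/d and 1 + k/d, where d = D/|G|. The
lower bound follows ∏(1 - j/d) ≥ 1 - ∑ j/d; the upper one uses k² ≤ d to absorb the cross terms. -/
theorem approxTwirl_one_bounds [Nonempty N]
    (hR : ∀ g, g ≠ 1 → Matrix.trace (R g : Matrix N N ℂ) = 0) {d : ℝ} (hd : 0 < d)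
    (hcard : (Fintype.card N : ℝ) = d * Fintype.card G) (k : ℕ) (hk : (k : ℝ) ^ 2 ≤ d) :
    (approxTwirl R k 1 - (1 - k ^ 2 / (2 * d)) • 1).PosSemidef ∧
      ((1 + k ^ 2 / d) • 1 - approxTwirl R k 1).PosSemidef := by
  induction k with
  | zero =>
    rw [approxTwirl_zero_one]
    simp [Matrix.PosSemidef.zero]
  | succ k ih =>
    have hk0 : (0 : ℝ) ≤ k := Nat.cast_nonneg k
    push_cast at hk
    have hG : (0 : ℝ) < Fintype.card G := by exact_mod_cast Fintype.card_pos
    have hkd : (k : ℝ) ^ 2 ≤ d := by nlinarith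
    have hkd' : (k : ℝ) ≤ d := by nlinarith
    obtain ⟨hl, hu⟩ := ih hkd
    have hC := isHermitian_approxTwirl_one R (k + 1)
    have hrec := approxTwirl_succ_one R hR k
    set J := ∑ q : Fin k, ∑ h, conjSwap R q h
    have hD : (Fintype.card N : ℂ)⁻¹ • J = (d * Fintype.card G)⁻¹ • J := by
      rw [← hcard, ← Complex.coe_smul]
      push_cast
      rfl
    rw [hD] at hrec
    set Y := 1 + (d * Fintype.card G)⁻¹ • J
    set L := liftCopies (approxTwirl R k 1) with hL
    have hYl : (Y - (1 - k / d) • 1).PosSemidef := by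
      convert (posSemidef_add_sum_conjSwap R (k := k)).smul
        (a := (d * Fintype.card G)⁻¹) (by positivity) using 1
      rw [smul_add, smul_smul, show (d * Fintype.card G)⁻¹ * (k * Fintype.card G) = k / d by
        field_simp]
      module
    have hYu : ((1 + k / d) • 1 - Y).PosSemidef := by
      convert (posSemidef_sub_sum_conjSwap R (k := k)).smul
        (a := (d * Fintype.card G)⁻¹) (by positivity) using 1
      rw [smul_sub, smul_smul, show (d * Fintype.card G)⁻¹ * (k * Fintype.card G) = k / d by
        field_simp]
      module
    have hkd1 : (k : ℝ) / d ≤ 1 := (div_le_one hd).2 hkd'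
    have hY : Y.PosSemidef := by
      convert hYl.add (Matrix.PosSemidef.one.smul (sub_nonneg.2 hkd1)) using 1
      module
    have hlift : ∀ r : ℝ, liftCopies (r • (1 : Matrix (Fin k → N) (Fin k → N) ℂ)) = r • 1 :=
      fun r => by
        rw [← Complex.coe_smul, map_smul, liftCopies_one, Complex.coe_smul]
    have hLl : (L - (1 - k ^ 2 / (2 * d)) • 1).PosSemidef := by
      have := posSemidef_liftCopies hl
      rwa [map_sub, hlift] at this
    have hLu : ((1 + k ^ 2 / d) • 1 - L).PosSemidef := by
      have := posSemidef_liftCopies hu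
      rwa [map_sub, hlift] at this
    have hq : (k : ℝ) ^ 2 / (2 * d) ≤ 1 := (div_le_one (by positivity)).2 (by linarith)
    have hLp : L.PosSemidef := by
      convert hLl.add (Matrix.PosSemidef.one.smul (sub_nonneg.2 hq)) using 1
      module
    -- Both factors are Hermitian and so is their product, the next Φ_a(1).
    have hYL : Commute Y L := by
      rw [hrec, Matrix.IsHermitian, Matrix.conjTranspose_mul, hLp.isHermitian.eq,
        hY.isHermitian.eq] at hC
      exact hC.symm
    rw [hrec]
    constructor
    · refine posSemidef_mul_sub_smul hYL hY hYl hLl (sub_nonneg.2 hq) ?_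
      have h1 : (1 - (k : ℝ) / d) * (1 - k ^ 2 / (2 * d)) - (1 - ((k + 1 : ℕ) : ℝ) ^ 2 / (2 * d)) =
          1 / (2 * d) + (k / d) * (k ^ 2 / (2 * d)) := by
        push_cast
        field_simp
        ring
      have h2 : 0 ≤ 1 / (2 * d) + (k / d) * (k ^ 2 / (2 * d)) := by positivity
      linarith
    · refine posSemidef_smul_sub_mul hYL hY hYu hLu (by positivity) ?_
      have h1 : (1 + ((k + 1 : ℕ) : ℝ) ^ 2 / d) - (1 + (k : ℝ) / d) * (1 + k ^ 2 / d) =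
          1 / d + (k / d) * (1 - k ^ 2 / d) := by
        push_cast
        field_simp
        ring
      have h2 : (k : ℝ) ^ 2 / d ≤ 1 := (div_le_one hd).2 hkd
      have h3 : 0 ≤ 1 / d + (k / d) * (1 - k ^ 2 / d) :=
        add_nonneg (by positivity) (mul_nonneg (by positivity) (sub_nonneg.2 h2))
      linarith

end bounds

/-! ### Characters of regular on-site actions and conclusion -/

section regular

theorem trace_tensor {ι : Type*} [Fintype ι] [DecidableEq ι] {c : ι → Type*} [∀ i, Fintype (c i)]
    (A : ∀ i, Matrix (c i) (c i) ℂ) : Matrix.trace (tensor A) = ∏ i, Matrix.trace (A i) := by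
  simp only [Matrix.trace, Matrix.diag_apply, tensor, Matrix.of_apply]
  rw [Finset.prod_univ_sum, Fintype.piFinset_univ]

/-- Left translation by g ≠ 1 has no fixed points, so the regular representation has zero diagonal.
-/
theorem IsRegularAction.trace_eq_zero {G : Type*} [Group G] [Fintype G] [DecidableEq G]
    {N : Type*} [Fintype N] [DecidableEq N] {R : G →* Matrix.unitaryGroup N ℂ}
    (h : IsRegularAction R) {g : G} (hg : g ≠ 1) : Matrix.trace (R g : Matrix N N ℂ) = 0 := by
  obtain ⟨d, W, hW, hW', h⟩ := h
  have h0 : Matrix.trace (regularMatrix g) = 0 := by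
    simp [Matrix.trace, regularMatrix, hg]
  rw [← Matrix.one_mul (R g : Matrix N N ℂ), ← hW, Matrix.mul_assoc, h, Matrix.trace_mul_comm,
    Matrix.mul_assoc, hW', Matrix.mul_one, Matrix.trace_kronecker, h0, zero_mul]

theorem trace_onSite_eq_zero {G : Type*} [Group G] [Fintype G] [DecidableEq G]
    {ι : Type*} [Fintype ι] [DecidableEq ι] [Nonempty ι]
    {c : ι → Type*} [∀ i, Fintype (c i)] [∀ i, DecidableEq (c i)]
    {R : ∀ i, G →* Matrix.unitaryGroup (c i) ℂ} (h : ∀ i, IsRegularAction (R i)) {g : G}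
    (hg : g ≠ 1) : Matrix.trace (onSite R g : Matrix (∀ i, c i) (∀ i, c i) ℂ) = 0 := by
  change Matrix.trace (tensor fun i => (R i g : Matrix (c i) (c i) ℂ)) = 0
  rw [trace_tensor]
  exact Finset.prod_eq_zero (Finset.mem_univ (Classical.arbitrary ι)) ((h _).trace_eq_zero hg)

theorem cple_twirl_symHaar_approxTwirl {G : Type*} [Group G] [Fintype G]
    {N : Type*} [Fintype N] [DecidableEq N] [Nonempty N] {R : G →* Matrix.unitaryGroup N ℂ}
    (hR : ∀ g, g ≠ 1 → Matrix.trace (R g : Matrix N N ℂ) = 0) {k : ℕ}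
    (hk : (k : ℝ) ^ 2 ≤ (Fintype.card N : ℝ) / Fintype.card G) {ε : ℝ}
    (hε : ε = (Fintype.card G : ℝ) * (k : ℝ) ^ 2 / Fintype.card N) :
    (CPLE (((1 - ε : ℝ) : ℂ) • twirl (symHaar R) k) (approxTwirl R k) ∧
      CPLE (approxTwirl R k) (((1 + ε : ℝ) : ℂ) • twirl (symHaar R) k)) ∧
    (CPLE (((1 - ε : ℝ) : ℂ) • approxTwirl R k) (twirl (symHaar R) k) ∧
      CPLE (twirl (symHaar R) k) (((1 + ε : ℝ) : ℂ) • approxTwirl R k)) := by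
  have hN : (0 : ℝ) < Fintype.card N := by exact_mod_cast Fintype.card_pos
  have hG : (0 : ℝ) < Fintype.card G := by exact_mod_cast Fintype.card_pos
  set d : ℝ := (Fintype.card N : ℝ) / Fintype.card G with hd
  have hd0 : 0 < d := by positivity
  -- With d = D/|G|, the parameter ε is k²/d, and the hypothesis on k says exactly ε ≤ 1.
  obtain ⟨hl, hu⟩ := approxTwirl_one_bounds hR hd0 (by rw [hd]; field_simp) k hk
  have hεd : ε = k ^ 2 / d := by
    rw [hε, hd]
    field_simp
  refine cple_of_approxTwirl_one_bounds (by rw [hεd]; positivity)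
    (by rw [hεd]; exact (div_le_one hd0).2 hk) ?_ ?_
  · rw [Complex.coe_smul]
    convert hl using 3
    rw [hεd]
    ring
  · rw [Complex.coe_smul, hεd]
    exact hu

end regular

end SymTwirl

end

theorem mainTheorem5
    {G : Type*} [Group G] [Fintype G] [DecidableEq G]
    {ι : Type*} [Fintype ι] [DecidableEq ι] [Nonempty ι]
    {c : ι → Type*} [∀ i, Fintype (c i)] [∀ i, DecidableEq (c i)] [∀ i, Nonempty (c i)]
    (R : ∀ i, G →* Matrix.unitaryGroup (c i) ℂ) (k : ℕ) :
    ((∀ i, SymTwirl.IsRegularAction (R i)) →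
      (k : ℝ) ^ 2 ≤ (Fintype.card (∀ i, c i) : ℝ) / Fintype.card G →
      ∀ ε : ℝ, ε = (Fintype.card G : ℝ) * (k : ℝ) ^ 2 / Fintype.card (∀ i, c i) →
        (SymTwirl.CPLE
            (((1 - ε : ℝ) : ℂ) • SymTwirl.twirl (SymTwirl.symHaar (SymTwirl.onSite R)) k)
            (SymTwirl.approxTwirl (SymTwirl.onSite R) k) ∧
          SymTwirl.CPLE
            (SymTwirl.approxTwirl (SymTwirl.onSite R) k)
            (((1 + ε : ℝ) : ℂ) • SymTwirl.twirl (SymTwirl.symHaar (SymTwirl.onSite R)) k)) ∧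
        (SymTwirl.CPLE
            (((1 - ε : ℝ) : ℂ) • SymTwirl.approxTwirl (SymTwirl.onSite R) k)
            (SymTwirl.twirl (SymTwirl.symHaar (SymTwirl.onSite R)) k) ∧
          SymTwirl.CPLE
            (SymTwirl.twirl (SymTwirl.symHaar (SymTwirl.onSite R)) k)
            (((1 + ε : ℝ) : ℂ) • SymTwirl.approxTwirl (SymTwirl.onSite R) k))) ∧
    (∀ (μ : MeasureTheory.Measure (SymTwirl.symUnitary (SymTwirl.onSite R)))
      [MeasureTheory.IsProbabilityMeasure μ], ∀ ε : ℝ,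
      ε = (Fintype.card (∀ i, c i) : ℝ) ^ (2 * k) /
            ((k.factorial : ℝ) * (Fintype.card G : ℝ) ^ k) *
          SymTwirl.opNorm (SymTwirl.ampliate
            (SymTwirl.twirl μ k - SymTwirl.approxTwirl (SymTwirl.onSite R) k)
            (SymTwirl.epr (Fin k → ∀ i, c i))) →
        SymTwirl.CPLE
            (((1 - ε : ℝ) : ℂ) • SymTwirl.approxTwirl (SymTwirl.onSite R) k)
            (SymTwirl.twirl μ k) ∧
          SymTwirl.CPLE
            (SymTwirl.twirl μ k)
            (((1 + ε : ℝ) : ℂ) • SymTwirl.approxTwirl (SymTwirl.onSite R) k)) := by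
  refine ⟨fun hreg hk ε hε => ?_, fun μ _ ε hε => ?_⟩
  · exact SymTwirl.cple_twirl_symHaar_approxTwirl
      (fun g hg => SymTwirl.trace_onSite_eq_zero hreg hg) hk hε
  · exact SymTwirl.cple_twirl_approxTwirl (SymTwirl.onSite R) μ ε hε
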